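/- **Setting.** Let $d,k\in\mathbb{N}=\{1,2,3,\dots\}$, $p\in\mathbb{R}$ with $p>1$, $R\in\mathbb{R}$ with $R\ge 1$, and put $s_p=\frac{2}{p-1}$. Let $\mathbb{B}^d_R\subset\mathbb{R}^d$ be the open ball of radius $R$ about $0$ and $\mathbb{S}^{d-1}_R$ its boundary sphere, integrals over which are taken with respect to the surface measure (counting measure on $\{-R,R\}$ if $d=1$). Let $C^\infty(\overline{\mathbb{B}^d_R})$ be the space of smooth functions $\mathbb{B}^d_R\to\mathbb{C}$ all of whose derivatives extend continuously to $\overline{\mathbb{B}^d_R}$. For $\mathbf{f}=(f_1,f_2)\in C^\infty(\overline{\mathbb{B}^d_R})^2$ define $$\mathbf{L}_{d,p}\mathbf{f}=\begin{bmatrix}-s_pf_1-\sum_{i=1}^d\xi^i\partial_if_1+f_2\\ \Delta f_1-(s_p+1)f_2-\sum_{i=1}^d\xi^i\partial_if_2\end{bmatrix},\qquad \mathbf{D}_0\mathbf{f}=\begin{bmatrix}f_2\\ \Delta f_1\end{bmatrix},\qquad \mathbf{D}_i\mathbf{f}=\begin{bmatrix}\partial_if_1\\ \partial_if_2\end{bmatrix}\quad(1\le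 i\le d).$$ Given positive weights $\varepsilon_j$ for integers $1\le j<\frac d2+1$, define sesquilinear forms on $C^\infty(\overline{\mathbb{B}^d_R})^2$ recursively by $$(\mathbf{f}\,|\,\mathbf{g})_{\mathfrak{E}^1}=\int_{\mathbb{B}^d_R}\sum_{i=1}^d\overline{\partial_if_1}\,\partial_ig_1+\int_{\mathbb{B}^d_R}\overline{f_2}\,g_2+\frac{2\varepsilon_1}{R}\int_{\mathbb{S}^{d-1}_R}\overline{f_1}\,g_1$$ and, for $k\ge2$, $$(\mathbf{f}\,|\,\mathbf{g})_{\mathfrak{E}^k}=\begin{cases}\displaystyle\sum_{\mu=0}^d(\mathbf{D}_\mu\mathbf{f}\,|\,\mathbf{D}_\mu\mathbf{g})_{\mathfrak{E}^{k-1}}+\frac{2\varepsilon_k}{R}\int_{\mathbb{S}^{d-1}_R}\overline{f_1}\,g_1&\text{if }k<\frac d2+1,\\[2ex] \displaystyle\sum_{\mu=0}^d(\mathbf{D}_\mu\mathbf{f}\,|\,\mathbf{D}_\mu\mathbf{g})_{\mathfrak{E}^{k-1}}+(\mathbf{f}\,|\,\mathbf{g})_{\mathfrak{E}^{k-1}}&\text{if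 }k\ge\frac d2+1,\end{cases}$$ and set $\|\mathbf{f}\|_{\mathfrak{E}^k}=\sqrt{(\mathbf{f}\,|\,\mathbf{f})_{\mathfrak{E}^k}}$. **Proposition 2.1.** Let $0<\varepsilon_1<\frac12$ and $$\varepsilon_j=\Big(\frac{\varepsilon_1}{16R^2}\Big)^{j-1}\varepsilon_1\prod_{i=1}^{j-1}\Big(\frac d2-i-\varepsilon_1\Big)\qquad\text{for integers }2\le j<\frac d2+1.$$ Then, for all $\mathbf{f}=(f_1,f_2)\in C^\infty(\overline{\mathbb{B}^d_R})^2$, $$\operatorname{Re}(\mathbf{L}_{d,p}\mathbf{f}\,|\,\mathbf{f})_{\mathfrak{E}^k}\le\begin{cases}\displaystyle\Big(\frac d2-s_p-k\Big)\|\mathbf{f}\|_{\mathfrak{E}^k}^2+\Big(-\frac d2+k+\varepsilon_1\Big)\frac{2\varepsilon_k}{R}\int_{\mathbb{S}^{d-1}_R}|f_1|^2&\text{if }k<\frac d2+1,\\[2ex] (-s_p+\varepsilon_1)\|\mathbf{f}\|_{\mathfrak{E}^k}^2&\text{if }k\ge\frac d2+1.\end{cases}$$ -/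

import Mathlib

noncomputable section

namespace WaveEnergy

open MeasureTheory Metric
open scoped ContDiff

/-- Euclidean space `ℝ^d`. -/
abbrev Space (d : ℕ) : Type := EuclideanSpace ℝ (Fin d)

/-- A pair `(f₁, f₂)` of complex-valued functions. Only the values on the closed ball of radius `R`
around the origin matter below; the values outside are irrelevant. -/
abbrev Pair (d : ℕ) : Type := (Space d → ℂ) × (Space d → ℂ)

/-- The pairs in `C^∞(closed ball)^2`: both components have derivatives of all orders which are
continuous up to the boundary. (The closed ball is convex with nonempty interior, so `ContDiffOn`
on it, in which derivatives at boundary points are taken within the closed ball, says exactly that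
the function is smooth inside and that all its derivatives extend continuously to the boundary.) -/
def IsSmoothPair {d : ℕ} (R : ℝ) (f : Pair d) : Prop :=
  ContDiffOn ℝ ∞ f.1 (closedBall 0 R) ∧ ContDiffOn ℝ ∞ f.2 (closedBall 0 R)

/-- The partial derivative `∂ᵢ f` on the closed ball of radius `R`; at boundary points it is the
continuous extension of the partial derivative in the interior when `f` is smooth up to the
boundary. -/
def partialDeriv {d : ℕ} (R : ℝ) (i : Fin d) (f : Space d → ℂ) : Space d → ℂ :=
  fun x => fderivWithin ℝ f (closedBall 0 R) x (EuclideanSpace.single i 1)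

/-- The Laplacian on the closed ball of radius `R`. -/
def laplace {d : ℕ} (R : ℝ) (f : Space d → ℂ) : Space d → ℂ :=
  InnerProductSpace.laplacianWithin f (closedBall 0 R)

/-- The scaling exponent `s_p = 2 / (p - 1)`. -/
def scalingExp (p : ℝ) : ℝ := 2 / (p - 1)

/-- The wave evolution operation in similarity coordinates,
`L f = (-s_p f₁ - ξ^i ∂ᵢ f₁ + f₂, Δ f₁ - (s_p + 1) f₂ - ξ^i ∂ᵢ f₂)`. -/
def waveOp {d : ℕ} (p R : ℝ) (f : Pair d) : Pair d :=
  (fun x => -(scalingExp p : ℂ) * f.1 x - ∑ i, (x i : ℂ) * partialDeriv R i f.1 x + f.2 x,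
   fun x => laplace R f.1 x - ((scalingExp p : ℂ) + 1) * f.2 x
      - ∑ i, (x i : ℂ) * partialDeriv R i f.2 x)

/-- The operators `D_μ`, `μ = 0, …, d`: `D_0 f = (f₂, Δ f₁)` and `D_i f = (∂ᵢ f₁, ∂ᵢ f₂)` for
`i = 1, …, d`. -/
def opD {d : ℕ} (R : ℝ) (μ : Fin (d + 1)) (f : Pair d) : Pair d :=
  Fin.cases (f.2, laplace R f.1) (fun i => (partialDeriv R i f.1, partialDeriv R i f.2)) μ

/-- The surface measure of the sphere of radius `R` around the origin, as a measure on `ℝ^d`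
(for `d ≥ 1`, `R > 0`): the image of the surface measure of the unit sphere under `ω ↦ R ω`, times
`R ^ (d - 1)`. For `d = 1` it is the counting measure on `{-R, R}`. -/
def sphereMeasure (d : ℕ) (R : ℝ) : Measure (Space d) :=
  ENNReal.ofReal (R ^ (d - 1)) •
    Measure.map (fun y : sphere (0 : Space d) 1 => R • (y : Space d))
      (volume : Measure (Space d)).toSphere

/-- The sesquilinear forms `(f | g)_{E^k}`, `k ≥ 1`, with boundary weights `ε j`; conjugate-linear
in the first argument. The value at `k = 0` is a placeholder that is never used. -/
def energyForm {d : ℕ} (R : ℝ) (ε : ℕ → ℝ) : ℕ → Pair d → Pair d → ℂ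
  | 0, _, _ => 0
  | 1, f, g =>
      (∫ x in ball (0 : Space d) R,
          ∑ i, starRingEnd ℂ (partialDeriv R i f.1 x) * partialDeriv R i g.1 x)
        + (∫ x in ball (0 : Space d) R, starRingEnd ℂ (f.2 x) * g.2 x)
        + ((2 * ε 1 / R : ℝ) : ℂ) * ∫ x, starRingEnd ℂ (f.1 x) * g.1 x ∂sphereMeasure d R
  | k + 2, f, g =>
      if ((k + 2 : ℕ) : ℝ) < (d : ℝ) / 2 + 1 then
        (∑ μ : Fin (d + 1), energyForm R ε (k + 1) (opD R μ f) (opD R μ g))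
          + ((2 * ε (k + 2) / R : ℝ) : ℂ) *
              ∫ x, starRingEnd ℂ (f.1 x) * g.1 x ∂sphereMeasure d R
      else
        (∑ μ : Fin (d + 1), energyForm R ε (k + 1) (opD R μ f) (opD R μ g))
          + energyForm R ε (k + 1) f g

/-- The energy norm `‖f‖_{E^k} = √ (f | f)_{E^k}`; the form is real and nonnegative on the diagonal
when the weights are positive. -/
def energyNorm {d : ℕ} (R : ℝ) (ε : ℕ → ℝ) (k : ℕ) (f : Pair d) : ℝ :=
  Real.sqrt (energyForm R ε k f f).re

end WaveEnergy

end

noncomputable section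

namespace WaveEnergy

open MeasureTheory Metric Set Filter Topology
open scoped ContDiff

variable {d : ℕ} {R : ℝ}

/-! Write Λ for the Euler operator and s for `scalingExp p`. Since ∂ᵢΛ = Λ∂ᵢ + ∂ᵢ and ΔΛ = ΛΔ + 2Δ,
every D_μ satisfies D_μ L = L D_μ − D_μ (`opD_waveOp`). The forms are built recursively from the
D_μ, so each additional order lowers the growth rate by one, and the proof is an induction on k in
which only boundary terms need care.

At order one, the divergence theorem turns the interior part of Re(Lf | f) into (d/2 − s − 1) times
the interior energy plus a flux through the sphere. With the weighted boundary term of the form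
added, the boundary integrand is bounded by completing a square (`boundary_quadratic_nonpos`); this
uses R ≥ 1.

From k to k+1 with k < d/2, the inductive hypothesis applied to all D_μ f yields a boundary term
with the negative coefficient −(d/2 − k − ε₁), multiplying the integral of |∇f₁|² + |f₂|² over the
sphere. The new weight ε_{k+1} creates a cross term between (Lf)₁ and f₁, bounded by the same
integral plus (ε₁ − s)|f₁|² (`boundary_cross_term_le`). The recursion `IsBoundaryWeight.succ` makes
the two contributions cancel exactly.

Once k ≥ d/2, the coefficient −d/2 + k + ε₁ is positive and the boundary term is absorbed into the
norm, which gives the rate −s + ε₁. Higher orders inherit this rate.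

The divergence theorem on the ball is proved by hand: along rays for radial fields, and from these
by a cutoff argument for constant directions. -/

/-! ### Surface measure, polar coordinates and radial fields -/

theorem uniqueDiffOn_closedBall (hR : 0 < R) :
    UniqueDiffOn ℝ (closedBall (0 : Space d) R) :=
  uniqueDiffOn_convex (convex_closedBall _ _)
    ⟨0, interior_mono ball_subset_closedBall (by simpa [isOpen_ball.interior_eq] using hR)⟩

theorem integrableOn_ball {E : Type*} [NormedAddCommGroup E] {u : Space d → E}
    (hu : ContinuousOn u (closedBall 0 R)) : IntegrableOn u (ball 0 R) :=
  (hu.integrableOn_compact (isCompact_closedBall _ _)).mono_set ball_subset_closedBall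

theorem smul_mem_closedBall {r : ℝ} (h0 : 0 ≤ r) (h1 : r ≤ R) (θ : sphere (0 : Space d) 1) :
    r • (θ : Space d) ∈ closedBall (0 : Space d) R := by
  simp [norm_smul, abs_of_nonneg h0, h1]

theorem continuous_comp_smul_sphere {E : Type*} [TopologicalSpace E] {u : Space d → E}
    (hR : 0 ≤ R) (hu : ContinuousOn u (closedBall 0 R)) :
    Continuous fun θ : sphere (0 : Space d) 1 => u (R • (θ : Space d)) :=
  hu.comp_continuous (by fun_prop) fun θ => smul_mem_closedBall hR le_rfl θ

theorem measurableEmbedding_smul_sphere (hR : 0 < R) :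
    MeasurableEmbedding (fun y : sphere (0 : Space d) 1 => R • (y : Space d)) := by
  refine (Continuous.isClosedEmbedding (by fun_prop) ?_).measurableEmbedding
  intro x y h
  exact Subtype.ext (smul_right_injective _ hR.ne' h)

theorem integral_sphereMeasure {E : Type*} [NormedAddCommGroup E] [NormedSpace ℝ E]
    (hR : 0 < R) (u : Space d → E) :
    ∫ x, u x ∂sphereMeasure d R =
      R ^ (d - 1) • ∫ θ, u (R • (θ : Space d)) ∂(volume : Measure (Space d)).toSphere := by
  rw [sphereMeasure, integral_smul_measure, (measurableEmbedding_smul_sphere hR).integral_map,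
    ENNReal.toReal_ofReal (by positivity)]

theorem integrable_sphereMeasure {E : Type*} [NormedAddCommGroup E] {u : Space d → E}
    (hR : 0 < R) (hu : ContinuousOn u (closedBall 0 R)) : Integrable u (sphereMeasure d R) := by
  rw [sphereMeasure]
  refine Integrable.smul_measure ?_ ENNReal.ofReal_ne_top
  rw [(measurableEmbedding_smul_sphere hR).integrable_map_iff]
  exact (continuous_comp_smul_sphere hR.le hu).integrable_of_hasCompactSupport
    (HasCompactSupport.of_compactSpace _)

theorem ae_sphereMeasure (hR : 0 < R) {P : Space d → Prop} (h : ∀ x, ‖x‖ = R → P x) :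
    ∀ᵐ x ∂sphereMeasure d R, P x := by
  rw [sphereMeasure]
  refine Measure.ae_smul_measure ?_ _
  rw [(measurableEmbedding_smul_sphere hR).ae_map_iff]
  exact .of_forall fun θ => h _ (by simp [norm_smul, abs_of_pos hR])

/-- Integration over a ball in polar coordinates. -/
theorem integral_ball_eq_polar (hd : 1 ≤ d) (hR : 0 < R) {u : Space d → ℝ}
    (hu : IntegrableOn u (ball 0 R)) :
    ∫ x in ball (0 : Space d) R, u x =
      ∫ θ, (∫ r in (0 : ℝ)..R, r ^ (d - 1) * u (r • (θ : Space d)))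
        ∂(volume : Measure (Space d)).toSphere := by
  -- For d ≥ 1 the space is nontrivial, so the origin, which polar coordinates omit, is a null set.
  have : Nonempty (Fin d) := ⟨⟨0, hd⟩⟩
  set v : Space d → ℝ := (ball (0 : Space d) R).indicator u with hv
  have hvi : Integrable v := (integrable_indicator_iff measurableSet_ball).2 hu
  have key := (volume : Measure (Space d)).measurePreserving_homeomorphUnitSphereProd
  have hdim : Module.finrank ℝ (Space d) - 1 = d - 1 := by simp
  rw [hdim] at key
  set G : sphere (0 : Space d) 1 × Ioi (0 : ℝ) → ℝ := fun p => v ((p.2 : ℝ) • (p.1 : Space d))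
    with hG
  have hcomp : ∀ x : ({0}ᶜ : Set (Space d)), G (homeomorphUnitSphereProd (Space d) x) = v x := by
    intro x
    have hx : ‖(x : Space d)‖ ≠ 0 := norm_ne_zero_iff.2 x.2
    simp [hG, smul_smul, hx]
  have hGi : Integrable G ((volume : Measure (Space d)).toSphere.prod
      (Measure.volumeIoiPow (d - 1))) := by
    rw [← key.integrable_comp_emb (Homeomorph.measurableEmbedding _)]
    have : (G ∘ homeomorphUnitSphereProd (Space d)) = v ∘ Subtype.val := funext hcomp
    rw [this]
    exact (integrableOn_iff_comap_subtypeVal (measurableSet_singleton _).compl).1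
      hvi.integrableOn
  calc ∫ x in ball (0 : Space d) R, u x = ∫ x, v x := (integral_indicator measurableSet_ball).symm
    _ = ∫ x : ({(0)}ᶜ : Set (Space d)), v x ∂(volume.comap Subtype.val) := by
      rw [integral_subtype_comap (measurableSet_singleton _).compl fun x ↦ v x,
        restrict_compl_singleton]
    _ = ∫ p, G p ∂((volume : Measure (Space d)).toSphere.prod
          (Measure.volumeIoiPow (d - 1))) := by
      rw [← key.integral_comp (Homeomorph.measurableEmbedding _)]
      exact integral_congr_ae (.of_forall fun x => (hcomp x).symm)
    _ = _ := by
      rw [integral_prod _ hGi]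
      refine integral_congr_ae (.of_forall fun θ => ?_)
      simp only [Measure.volumeIoiPow, ENNReal.ofReal]
      rw [integral_withDensity_eq_integral_smul
        (measurable_subtype_coe.pow_const _).real_toNNReal,
        integral_subtype_comap measurableSet_Ioi
          fun a ↦ Real.toNNReal (a ^ (d - 1)) • v (a • (θ : Space d)),
        intervalIntegral.integral_of_le hR.le, integral_Ioc_eq_integral_Ioo,
        ← integral_indicator measurableSet_Ioi, ← integral_indicator measurableSet_Ioo]
      refine integral_congr_ae (.of_forall fun r => ?_)
      by_cases h0 : 0 < r
      · by_cases h1 : r < R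
        · have : r • (θ : Space d) ∈ ball (0 : Space d) R := by
            simpa [norm_smul, abs_of_pos h0] using h1
          simp [h0, h1, hv, indicator_of_mem this, NNReal.smul_def,
            max_eq_left (pow_nonneg h0.le (d - 1))]
        · have : r • (θ : Space d) ∉ ball (0 : Space d) R := by
            simpa [norm_smul, abs_of_pos h0] using h1
          simp [h0, h1, hv, indicator_of_notMem this]
      · simp [h0]

/-- The divergence theorem on a ball for a radial vector field `u(x) x`. -/
theorem integral_ball_radial (hd : 1 ≤ d) (hR : 0 < R) {u : Space d → ℝ}
    (hu : ContDiffOn ℝ 1 u (closedBall 0 R)) :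
    ∫ x in ball (0 : Space d) R, (d * u x + fderivWithin ℝ u (closedBall 0 R) x x) =
      R * ∫ x, u x ∂sphereMeasure d R := by
  have hD : ContinuousOn (fderivWithin ℝ u (closedBall 0 R)) (closedBall (0 : Space d) R) :=
    hu.continuousOn_fderivWithin (uniqueDiffOn_closedBall hR) le_rfl
  have hDx : ContinuousOn (fun x => (d : ℝ) * u x + fderivWithin ℝ u (closedBall 0 R) x x)
      (closedBall (0 : Space d) R) :=
    (continuousOn_const.mul hu.continuousOn).add (hD.clm_apply continuousOn_id)
  rw [integral_ball_eq_polar hd hR (integrableOn_ball hDx), integral_sphereMeasure hR, smul_eq_mul,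
    ← mul_assoc, ← integral_const_mul]
  refine integral_congr_ae (.of_forall fun θ => ?_)
  have hline : MapsTo (fun r : ℝ => r • (θ : Space d)) (Icc 0 R) (closedBall 0 R) :=
    fun r hr => smul_mem_closedBall hr.1 hr.2 θ
  have hcont : ContinuousOn (fun r : ℝ => u (r • (θ : Space d))) (Icc 0 R) :=
    hu.continuousOn.comp (by fun_prop) hline
  have hcont' : ContinuousOn (fun r : ℝ => (d : ℝ) * u (r • (θ : Space d))
      + fderivWithin ℝ u (closedBall 0 R) (r • (θ : Space d)) (r • (θ : Space d))) (Icc 0 R) :=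
    hDx.comp (by fun_prop) hline
  -- On each ray the integrand, including the Jacobian, is the derivative of r^d u(rθ), which
  -- vanishes at r = 0 because d ≥ 1.
  have hftc := intervalIntegral.integral_eq_sub_of_hasDerivAt_of_le (a := 0) (b := R)
    (f := fun r : ℝ => r ^ d * u (r • (θ : Space d)))
    (f' := fun r : ℝ => r ^ (d - 1) * ((d : ℝ) * u (r • (θ : Space d))
      + fderivWithin ℝ u (closedBall 0 R) (r • (θ : Space d)) (r • (θ : Space d)))) hR.le
    ((continuous_pow d).continuousOn.mul hcont) ?_ ?_
  · simp only at hftc ⊢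
    rw [hftc]
    obtain ⟨e, rfl⟩ : ∃ e, d = e + 1 := ⟨d - 1, by omega⟩
    simp only [Nat.add_sub_cancel, zero_pow (Nat.succ_ne_zero e), zero_mul, sub_zero, pow_succ]
    ring
  · intro r hr
    have hmem : r • (θ : Space d) ∈ ball (0 : Space d) R := by
      simpa [norm_smul, abs_of_pos hr.1] using hr.2
    have hnhds : closedBall (0 : Space d) R ∈ 𝓝 (r • (θ : Space d)) :=
      mem_of_superset (isOpen_ball.mem_nhds hmem) ball_subset_closedBall
    have h1 : HasFDerivAt u (fderivWithin ℝ u (closedBall 0 R) (r • (θ : Space d)))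
        (r • (θ : Space d)) :=
      ((hu.differentiableOn one_ne_zero _ (ball_subset_closedBall hmem)).hasFDerivWithinAt).hasFDerivAt
        hnhds
    have h2 : HasDerivAt (fun r : ℝ => r • (θ : Space d)) ((1 : ℝ) • (θ : Space d)) r :=
      (hasDerivAt_id r).smul_const _
    have h3 := (hasDerivAt_pow d r).mul (h1.comp_hasDerivAt r h2)
    refine h3.congr_deriv ?_
    obtain ⟨e, rfl⟩ : ∃ e, d = e + 1 := ⟨d - 1, by omega⟩
    simp [pow_succ]
    ring
  · refine ContinuousOn.intervalIntegrable ?_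
    rw [uIcc_of_le hR.le]
    exact (continuous_pow _).continuousOn.mul hcont'

/-! ### Divergence theorem for constant directions -/

theorem continuousOn_fderivWithin_closedBall {E : Type*} [NormedAddCommGroup E] [NormedSpace ℝ E]
    {u : Space d → E} (hR : 0 < R) (hu : ContDiffOn ℝ 1 u (closedBall 0 R)) :
    ContinuousOn (fderivWithin ℝ u (closedBall 0 R)) (closedBall (0 : Space d) R) :=
  hu.continuousOn_fderivWithin (uniqueDiffOn_closedBall hR) le_rfl

/-- Quadratic vanishing at the sphere makes the extension by zero differentiable on the whole space,
with derivative zero off the open ball. Integration by parts on the whole space against the constant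
1 then leaves no boundary term. -/
theorem integral_fderivWithin_eq_zero (hR : 0 < R) {g : Space d → ℝ}
    (hg : ContDiffOn ℝ 1 g (closedBall 0 R)) {C : ℝ}
    (hC : ∀ x ∈ ball (0 : Space d) R, |g x| ≤ C * (R - ‖x‖) ^ 2) (v : Space d) :
    ∫ x in ball (0 : Space d) R, fderivWithin ℝ g (closedBall 0 R) x v = 0 := by
  have hC0 : 0 ≤ C := by
    have := (abs_nonneg _).trans (hC 0 (by simpa using hR))
    have hR2 : 0 < (R - ‖(0 : Space d)‖) ^ 2 := by rw [norm_zero, sub_zero]; positivity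
    exact nonneg_of_mul_nonneg_left this hR2
  set h : Space d → ℝ := (ball (0 : Space d) R).indicator g with hh
  set h' : Space d → Space d →L[ℝ] ℝ :=
    (ball (0 : Space d) R).indicator (fderivWithin ℝ g (closedBall 0 R)) with hh'
  have hder : ∀ x, HasFDerivAt h (h' x) x := by
    intro x
    by_cases hx : x ∈ ball (0 : Space d) R
    · have hb := isOpen_ball.mem_nhds hx
      have h1 : HasFDerivAt g (fderivWithin ℝ g (closedBall 0 R) x) x :=
        ((hg.differentiableOn one_ne_zero _
          (ball_subset_closedBall hx)).hasFDerivWithinAt).hasFDerivAt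
          (mem_of_superset hb ball_subset_closedBall)
      rw [hh', indicator_of_mem hx]
      refine h1.congr_of_eventuallyEq ?_
      filter_upwards [hb] with y hy
      rw [hh, indicator_of_mem hy]
    · rw [hh', indicator_of_notMem hx]
      -- For x off the open ball and y inside it, R − ‖y‖ ≤ ‖x‖ − ‖y‖ ≤ ‖y − x‖, so the extension is
      -- O(‖y − x‖²) at x.
      refine Asymptotics.IsBigO.hasFDerivAt (n := 2) ?_ one_lt_two
      refine Asymptotics.IsBigO.of_bound C (.of_forall fun y => ?_)
      rw [hh]
      by_cases hy : y ∈ ball (0 : Space d) R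
      · rw [indicator_of_mem hy, Real.norm_eq_abs, norm_pow, norm_norm]
        refine (hC y hy).trans ?_
        have h1 : R ≤ ‖x‖ := by simpa using hx
        have h2 : ‖y‖ < R := by simpa using hy
        have h3 : ‖x‖ - ‖y‖ ≤ ‖y - x‖ := by
          rw [← norm_neg (y - x), neg_sub]; exact norm_sub_norm_le x y
        gcongr
        linarith
      · rw [indicator_of_notMem hy, norm_zero]
        positivity
  have hint : Integrable fun x => h' x v := by
    have : (fun x => h' x v) = (ball (0 : Space d) R).indicator
        (fun x => fderivWithin ℝ g (closedBall 0 R) x v) := by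
      ext x
      by_cases hx : x ∈ ball (0 : Space d) R
      · rw [hh', indicator_of_mem hx, indicator_of_mem hx]
      · rw [hh', indicator_of_notMem hx, indicator_of_notMem hx]; rfl
    rw [this, integrable_indicator_iff measurableSet_ball]
    exact integrableOn_ball ((continuousOn_fderivWithin_closedBall hR hg).clm_apply
      continuousOn_const)
  have hint0 : Integrable h :=
    (integrable_indicator_iff measurableSet_ball).2 (integrableOn_ball hg.continuousOn)
  have key := integral_bilinear_hasFDerivAt_right_eq_neg_left_of_integrable (μ := volume)
    (f := fun _ : Space d => (1 : ℝ)) (f' := fun _ => 0) (g := h) (g' := h') (v := v)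
    (B := ContinuousLinearMap.mul ℝ ℝ) (by simp) (by simpa using hint) (by simpa using hint0)
    (fun x _ => hasFDerivAt_const _ _) (fun x _ => hder x)
  simp only [ContinuousLinearMap.mul_apply', one_mul, zero_apply, zero_mul,
    integral_zero, neg_zero] at key
  rw [← key, ← integral_indicator measurableSet_ball]
  congr 1
  ext x
  by_cases hx : x ∈ ball (0 : Space d) R
  · rw [hh', indicator_of_mem hx, indicator_of_mem hx]
  · rw [hh', indicator_of_notMem hx, indicator_of_notMem hx]; rfl

/-- The squared relative radius `‖x‖² / R²`. -/
def sqRadius (R : ℝ) (x : Space d) : ℝ := ‖x‖ ^ 2 / R ^ 2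

theorem contDiff_sqRadius {n : WithTop ℕ∞} : ContDiff ℝ n (sqRadius R : Space d → ℝ) :=
  (contDiff_norm_sq ℝ).div_const _

theorem hasFDerivAt_sqRadius (x : Space d) :
    HasFDerivAt (sqRadius R) ((2 / R ^ 2) • innerSL ℝ x) x := by
  have := ((hasStrictFDerivAt_norm_sq x).hasFDerivAt).mul_const (R ^ 2)⁻¹
  refine (this.congr_fderiv ?_)
  ext y
  simp
  ring

theorem sqRadius_nonneg (x : Space d) : 0 ≤ sqRadius R x := by unfold sqRadius; positivity

theorem sqRadius_lt_one (hR : 0 < R) {x : Space d} (hx : x ∈ ball (0 : Space d) R) :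
    sqRadius R x < 1 := by
  have : ‖x‖ < R := by simpa using hx
  rw [sqRadius, div_lt_one (by positivity)]
  gcongr

theorem sqRadius_eq_one (hR : 0 < R) {x : Space d} (hx : ‖x‖ = R) : sqRadius R x = 1 := by
  rw [sqRadius, hx, div_self (by positivity)]

theorem one_sub_sqRadius_le (hR : 0 < R) {x : Space d} (hx : x ∈ ball (0 : Space d) R) :
    1 - sqRadius R x ≤ 2 / R * (R - ‖x‖) := by
  have : ‖x‖ < R := by simpa using hx
  rw [sqRadius]
  have h : 2 / R * (R - ‖x‖) - (1 - ‖x‖ ^ 2 / R ^ 2) = (R - ‖x‖) ^ 2 / R ^ 2 := by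
    field_simp
    ring
  have := div_nonneg (sq_nonneg (R - ‖x‖)) (sq_nonneg R)
  linarith

theorem tendsto_integral_sqRadius_pow (hR : 0 < R) {c : Space d → ℝ}
    (hc : ContinuousOn c (closedBall 0 R)) :
    Tendsto (fun n : ℕ => ∫ x in ball (0 : Space d) R, sqRadius R x ^ n * c x) atTop (𝓝 0) := by
  have := tendsto_integral_of_dominated_convergence (μ := volume.restrict (ball (0 : Space d) R))
    (F := fun n x => sqRadius R x ^ n * c x) (f := fun _ => 0) (fun x => ‖c x‖)
    (fun n => (integrableOn_ball
      (((contDiff_sqRadius (n := 0)).continuous.pow n).continuousOn.mul hc)).aestronglyMeasurable)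
    (integrableOn_ball hc).norm
    (fun n => (ae_restrict_iff' measurableSet_ball).2 (.of_forall fun x hx => ?_))
    ((ae_restrict_iff' measurableSet_ball).2 (.of_forall fun x hx => ?_))
  · simpa using this
  · rw [norm_mul, norm_pow, Real.norm_of_nonneg (sqRadius_nonneg x)]
    exact mul_le_of_le_one_left (norm_nonneg _)
      (pow_le_one₀ (sqRadius_nonneg x) (sqRadius_lt_one hR hx).le)
  · simpa using (tendsto_pow_atTop_nhds_zero_of_lt_one (sqRadius_nonneg x)
      (sqRadius_lt_one hR hx)).mul_const (c x)

/-- The densities 2(n+1)qⁿ, with q the squared relative radius, concentrate on the sphere. Since the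
Euler derivative of qⁿ is 2n qⁿ, the radial divergence theorem for qⁿb gives 2n ∫ qⁿb as the sphere
integral minus an interior integral weighted by qⁿ, which tends to zero by dominated convergence. -/
theorem tendsto_integral_concentrate (hd : 1 ≤ d) (hR : 0 < R) {b : Space d → ℝ}
    (hb : ContDiffOn ℝ 1 b (closedBall 0 R)) :
    Tendsto (fun n : ℕ => 2 * (n + 1 : ℝ) *
      ∫ x in ball (0 : Space d) R, sqRadius R x ^ n * b x) atTop
      (𝓝 (R * ∫ x, b x ∂sphereMeasure d R)) := by
  set e : Space d → ℝ := fun x => d * b x + fderivWithin ℝ b (closedBall 0 R) x x with he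
  have hec : ContinuousOn e (closedBall 0 R) :=
    (continuousOn_const.mul hb.continuousOn).add
      ((continuousOn_fderivWithin_closedBall hR hb).clm_apply continuousOn_id)
  have hq : ∀ n : ℕ, ContinuousOn (fun x : Space d => sqRadius R x ^ n) (closedBall 0 R) :=
    fun n => ((contDiff_sqRadius (n := 0)).continuous.pow n).continuousOn
  have hrad : ∀ n : ℕ, 2 * (n + 1 : ℝ) * ∫ x in ball (0 : Space d) R, sqRadius R x ^ n * b x =
      R * (∫ x, b x ∂sphereMeasure d R) - (∫ x in ball (0 : Space d) R, sqRadius R x ^ n * e x)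
        + 2 * ∫ x in ball (0 : Space d) R, sqRadius R x ^ n * b x := by
    intro n
    have hu : ContDiffOn ℝ 1 (fun x : Space d => sqRadius R x ^ n * b x) (closedBall 0 R) :=
      (contDiff_sqRadius.pow n).contDiffOn.mul hb
    have h1 := integral_ball_radial hd hR hu
    have h2 : ∫ x, sqRadius R x ^ n * b x ∂sphereMeasure d R = ∫ x, b x ∂sphereMeasure d R := by
      refine integral_congr_ae (ae_sphereMeasure hR fun x hx => ?_)
      simp [sqRadius_eq_one hR hx]
    rw [h2] at h1
    rw [← h1]
    have h3 : ∫ x in ball (0 : Space d) R, ((d : ℝ) * (sqRadius R x ^ n * b x)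
          + fderivWithin ℝ (fun x : Space d => sqRadius R x ^ n * b x) (closedBall 0 R) x x) =
        ∫ x in ball (0 : Space d) R,
          (2 * (n : ℝ) * (sqRadius R x ^ n * b x) + sqRadius R x ^ n * e x) := by
      refine setIntegral_congr_fun measurableSet_ball fun x hx => ?_
      have hx' := ball_subset_closedBall hx
      have hd1 := (((hasFDerivAt_sqRadius (R := R) x).pow n).hasFDerivWithinAt
        (s := closedBall 0 R)).fun_mul (hb.differentiableOn one_ne_zero x hx').hasFDerivWithinAt
      simp only [hd1.fderivWithin (uniqueDiffOn_closedBall hR x hx'), he]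
      rcases n with _ | n
      · simp
      · have hxx : 2 / R ^ 2 * ‖x‖ ^ 2 = 2 * sqRadius R x := by rw [sqRadius]; ring
        simp only [nsmul_eq_mul, Nat.add_sub_cancel, add_apply,
          smul_apply, innerSL_apply_apply, real_inner_self_eq_norm_sq,
          smul_eq_mul, pow_succ]
        push_cast
        linear_combination (b x * sqRadius R x ^ n * (n + 1)) * hxx
    have i1 : IntegrableOn (fun x => sqRadius R x ^ n * b x) (ball 0 R) :=
      integrableOn_ball ((hq n).mul hb.continuousOn)
    have i2 : IntegrableOn (fun x => sqRadius R x ^ n * e x) (ball 0 R) :=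
      integrableOn_ball ((hq n).mul hec)
    rw [h3, integral_add (i1.const_mul _) i2, integral_const_mul]
    ring
  simp_rw [hrad]
  simpa using (tendsto_const_nhds.sub (tendsto_integral_sqRadius_pow hR hec)).add
    ((tendsto_integral_sqRadius_pow hR hb.continuousOn).const_mul 2)

/-- The divergence theorem on a ball for a vector field `u(x) v` of constant direction. -/
theorem integral_ball_fderivWithin (hd : 1 ≤ d) (hR : 0 < R) {u : Space d → ℝ}
    (hu : ContDiffOn ℝ 1 u (closedBall 0 R)) (v : Space d) :
    ∫ x in ball (0 : Space d) R, fderivWithin ℝ u (closedBall 0 R) x v =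
      R⁻¹ * ∫ x, inner ℝ x v * u x ∂sphereMeasure d R := by
  set b : Space d → ℝ := fun x => inner ℝ x v * u x with hb
  set D : Space d → ℝ := fun x => fderivWithin ℝ u (closedBall 0 R) x v with hD
  have hbc : ContDiffOn ℝ 1 b (closedBall 0 R) :=
    (contDiff_id.inner ℝ contDiff_const).contDiffOn.mul hu
  have hDc : ContinuousOn D (closedBall 0 R) :=
    (continuousOn_fderivWithin_closedBall hR hu).clm_apply continuousOn_const
  have hq : ∀ n : ℕ, ContinuousOn (fun x : Space d => sqRadius R x ^ n) (closedBall 0 R) :=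
    fun n => ((contDiff_sqRadius (n := 0)).continuous.pow n).continuousOn
  set I : ℕ → ℝ := fun n => ∫ x in ball (0 : Space d) R, sqRadius R x ^ n * D x with hI
  set J : ℕ → ℝ := fun n => 2 * (n + 1 : ℝ) * ∫ x in ball (0 : Space d) R,
    sqRadius R x ^ n * b x with hJ
  -- The field (1 − q^(n+1))² u has zero total derivative; the square of the cutoff supplies the
  -- quadratic vanishing. Expanding the derivative of the cutoff produces the two concentrating
  -- integrals on the right.
  have hrel : ∀ n : ℕ, (∫ x in ball (0 : Space d) R, D x) - 2 * I (n + 1) + I (2 * n + 2) =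
      2 / R ^ 2 * J n - 1 / R ^ 2 * J (2 * n + 1) := by
    intro n
    have hg : ContDiffOn ℝ 1 (fun x : Space d => (1 - sqRadius R x ^ (n + 1)) ^ 2 * u x)
        (closedBall 0 R) :=
      ((contDiff_const.sub (contDiff_sqRadius.pow (n + 1))).pow 2).contDiffOn.mul hu
    obtain ⟨C, hC⟩ := (isCompact_closedBall (0 : Space d) R).exists_bound_of_continuousOn
      hu.continuousOn
    have h0 := integral_fderivWithin_eq_zero hR hg (C := ((n + 1 : ℝ) * (2 / R)) ^ 2 * C) ?_ v
    · have h1 : ∀ x ∈ ball (0 : Space d) R,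
          fderivWithin ℝ (fun x : Space d => (1 - sqRadius R x ^ (n + 1)) ^ 2 * u x)
            (closedBall 0 R) x v =
          (D x - 2 * (sqRadius R x ^ (n + 1) * D x) + sqRadius R x ^ (2 * n + 2) * D x)
          - (2 / R ^ 2 * (2 * (n + 1 : ℝ)) * (sqRadius R x ^ n * b x)
            - 1 / R ^ 2 * (2 * ((2 * n + 1 : ℕ) + 1 : ℝ)) *
              (sqRadius R x ^ (2 * n + 1) * b x)) := by
        intro x hx
        have hx' := ball_subset_closedBall hx
        have hd1 := (((((hasFDerivAt_sqRadius (R := R) x).pow (n + 1)).const_sub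
          1).pow 2).hasFDerivWithinAt (s := closedBall 0 R)).fun_mul
          (hu.differentiableOn one_ne_zero x hx').hasFDerivWithinAt
        rw [hd1.fderivWithin (uniqueDiffOn_closedBall hR x hx')]
        simp only [nsmul_eq_mul, Nat.add_sub_cancel, add_apply,
          smul_apply, innerSL_apply_apply, neg_apply,
          smul_eq_mul, hb, hD]
        push_cast
        ring
      rw [setIntegral_congr_fun measurableSet_ball h1] at h0
      have iD := integrableOn_ball hDc
      have iqD : ∀ m : ℕ, IntegrableOn (fun x => sqRadius R x ^ m * D x) (ball 0 R) :=
        fun m => integrableOn_ball ((hq m).mul hDc)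
      have iqb : ∀ m : ℕ, IntegrableOn (fun x => sqRadius R x ^ m * b x) (ball 0 R) :=
        fun m => integrableOn_ball ((hq m).mul hbc.continuousOn)
      have i1 := (iqD (n + 1)).const_mul 2
      have i2 := (iqb n).const_mul (2 / R ^ 2 * (2 * (n + 1 : ℝ)))
      have i3 := (iqb (2 * n + 1)).const_mul (1 / R ^ 2 * (2 * ((2 * n + 1 : ℕ) + 1 : ℝ)))
      have i4 : IntegrableOn (fun x => D x - 2 * (sqRadius R x ^ (n + 1) * D x)) (ball 0 R) :=
        iD.sub i1
      have i5 : IntegrableOn (fun x => 2 / R ^ 2 * (2 * (n + 1 : ℝ)) * (sqRadius R x ^ n * b x)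
          - 1 / R ^ 2 * (2 * ((2 * n + 1 : ℕ) + 1 : ℝ)) * (sqRadius R x ^ (2 * n + 1) * b x))
          (ball 0 R) := i2.sub i3
      rw [integral_sub (i4.fun_add (iqD (2 * n + 2))) i5,
        integral_add i4 (iqD (2 * n + 2)), integral_sub iD i1, integral_sub i2 i3,
        integral_const_mul, integral_const_mul, integral_const_mul] at h0
      simp only [hI, hJ]
      linarith
    · intro x hx
      have hq0 := sqRadius_nonneg (R := R) x
      have hq1 := sqRadius_lt_one hR hx
      -- Bernoulli's inequality bounds the cutoff by a multiple of the distance to the sphere.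
      have hber : 1 - sqRadius R x ^ (n + 1) ≤ (n + 1) * (1 - sqRadius R x) := by
        have := one_add_mul_le_pow (a := sqRadius R x - 1) (by linarith) (n + 1)
        push_cast at this
        rw [add_sub_cancel] at this
        linarith
      have hw0 : 0 ≤ 1 - sqRadius R x ^ (n + 1) := by
        have := pow_le_one₀ (n := n + 1) hq0 hq1.le
        linarith
      have hw : 1 - sqRadius R x ^ (n + 1) ≤ (n + 1) * (2 / R) * (R - ‖x‖) := by
        refine hber.trans ?_
        rw [mul_assoc]
        gcongr
        exact one_sub_sqRadius_le hR hx
      have hu' := hC x (ball_subset_closedBall hx)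
      rw [Real.norm_eq_abs] at hu'
      rw [abs_mul, abs_of_nonneg (sq_nonneg _)]
      calc (1 - sqRadius R x ^ (n + 1)) ^ 2 * |u x|
          ≤ ((n + 1) * (2 / R) * (R - ‖x‖)) ^ 2 * C := by gcongr
        _ = _ := by ring
  have hIlim : Tendsto I atTop (𝓝 0) := tendsto_integral_sqRadius_pow hR hDc
  have hJlim : Tendsto J atTop (𝓝 (R * ∫ x, b x ∂sphereMeasure d R)) :=
    tendsto_integral_concentrate hd hR hbc
  have t1 : Tendsto (fun n : ℕ => n + 1) atTop atTop := tendsto_add_atTop_nat 1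
  have t2 : Tendsto (fun n : ℕ => 2 * n + 2) atTop atTop :=
    tendsto_atTop_mono (fun n => by simp only [id]; omega) tendsto_id
  have t3 : Tendsto (fun n : ℕ => 2 * n + 1) atTop atTop :=
    tendsto_atTop_mono (fun n => by simp only [id]; omega) tendsto_id
  have hL : Tendsto (fun n : ℕ => (∫ x in ball (0 : Space d) R, D x) - 2 * I (n + 1)
      + I (2 * n + 2)) atTop (𝓝 ((∫ x in ball (0 : Space d) R, D x) - 2 * 0 + 0)) :=
    (tendsto_const_nhds.sub ((hIlim.comp t1).const_mul 2)).add (hIlim.comp t2)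
  have hRt := (hJlim.const_mul (2 / R ^ 2)).sub ((hJlim.comp t3).const_mul (1 / R ^ 2))
  have := tendsto_nhds_unique hL (hRt.congr fun n => (hrel n).symm)
  -- Both concentrating sequences have the same limit, so the coefficients 2 and −1 leave one copy
  -- of it.
  have hR2 : 2 / R ^ 2 * (R * ∫ x, b x ∂sphereMeasure d R)
      - 1 / R ^ 2 * (R * ∫ x, b x ∂sphereMeasure d R) = R⁻¹ * ∫ x, b x ∂sphereMeasure d R := by
    field_simp
    ring
  rw [← hR2, ← this]
  ring

/-! ### Calculus up to the boundary and commutators with Λ -/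

theorem two_le_infty : (2 : WithTop ℕ∞) ≤ ∞ :=
  WithTop.coe_le_coe.2 (le_top : (2 : ℕ∞) ≤ ⊤)

/-- Smoothness up to the boundary of the ball of radius `R`. -/
abbrev SmoothOnBall {E : Type*} [NormedAddCommGroup E] [NormedSpace ℝ E] (R : ℝ)
    (u : Space d → E) : Prop :=
  ContDiffOn ℝ ∞ u (closedBall 0 R)

/-- The Euler operator `ξ^i ∂ᵢ`. -/
def eulerOp (R : ℝ) (u : Space d → ℂ) : Space d → ℂ :=
  fun x => ∑ i, (x i : ℂ) * partialDeriv R i u x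

theorem SmoothOnBall.hasFDerivWithinAt {E : Type*} [NormedAddCommGroup E] [NormedSpace ℝ E]
    {u : Space d → E} (hu : SmoothOnBall R u) {x : Space d} (hx : x ∈ closedBall 0 R) :
    HasFDerivWithinAt u (fderivWithin ℝ u (closedBall 0 R) x) (closedBall 0 R) x :=
  (hu.differentiableOn (by simp) x hx).hasFDerivWithinAt

theorem smoothOnBall_coord (i : Fin d) : SmoothOnBall R fun x : Space d => (x i : ℂ) :=
  (Complex.ofRealCLM.contDiff.comp
    (EuclideanSpace.proj i : Space d →L[ℝ] ℝ).contDiff).contDiffOn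

theorem SmoothOnBall.partialDeriv (hR : 0 < R) {u : Space d → ℂ} (hu : SmoothOnBall R u)
    (i : Fin d) : SmoothOnBall R (partialDeriv R i u) :=
  (hu.fderivWithin (uniqueDiffOn_closedBall hR) (by simp)).clm_apply contDiffOn_const

theorem SmoothOnBall.eulerOp (hR : 0 < R) {u : Space d → ℂ} (hu : SmoothOnBall R u) :
    SmoothOnBall R (eulerOp R u) :=
  ContDiffOn.sum fun i _ => (smoothOnBall_coord i).mul (hu.partialDeriv hR i)

theorem partialDeriv_congr (i : Fin d) {u v : Space d → ℂ} (h : EqOn u v (closedBall 0 R)) :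
    EqOn (partialDeriv R i u) (partialDeriv R i v) (closedBall 0 R) := by
  intro x hx
  simp only [partialDeriv, fderivWithin_congr h (h hx)]

theorem laplace_congr (hR : 0 < R) {u v : Space d → ℂ} (h : EqOn u v (closedBall 0 R)) :
    EqOn (laplace R u) (laplace R v) (closedBall 0 R) := by
  intro x hx
  exact (InnerProductSpace.laplacianWithin_congr_nhdsWithin
    (eventuallyEq_nhdsWithin_of_eqOn h) (uniqueDiffOn_closedBall hR)).eq_of_nhdsWithin hx

section

variable (hR : 0 < R) {u v : Space d → ℂ} {x : Space d}
include hR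

theorem partialDeriv_eq (hx : x ∈ closedBall 0 R) {u' : Space d →L[ℝ] ℂ}
    (h : HasFDerivWithinAt u u' (closedBall 0 R) x) (i : Fin d) :
    partialDeriv R i u x = u' (EuclideanSpace.single i 1) := by
  rw [partialDeriv, h.fderivWithin (uniqueDiffOn_closedBall hR x hx)]

theorem partialDeriv_add (hu : SmoothOnBall R u) (hv : SmoothOnBall R v)
    (hx : x ∈ closedBall 0 R) (i : Fin d) :
    partialDeriv R i (fun y => u y + v y) x = partialDeriv R i u x + partialDeriv R i v x :=
  partialDeriv_eq hR hx ((hu.hasFDerivWithinAt hx).fun_add (hv.hasFDerivWithinAt hx)) i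

theorem partialDeriv_sub (hu : SmoothOnBall R u) (hv : SmoothOnBall R v)
    (hx : x ∈ closedBall 0 R) (i : Fin d) :
    partialDeriv R i (fun y => u y - v y) x = partialDeriv R i u x - partialDeriv R i v x :=
  partialDeriv_eq hR hx ((hu.hasFDerivWithinAt hx).fun_sub (hv.hasFDerivWithinAt hx)) i

theorem partialDeriv_const_mul (hu : SmoothOnBall R u) (c : ℂ)
    (hx : x ∈ closedBall 0 R) (i : Fin d) :
    partialDeriv R i (fun y => c * u y) x = c * partialDeriv R i u x :=
  partialDeriv_eq hR hx ((hu.hasFDerivWithinAt hx).const_mul c) i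

theorem partialDeriv_sum {ι : Type*} (s : Finset ι) {w : ι → Space d → ℂ}
    (hw : ∀ j, SmoothOnBall R (w j)) (hx : x ∈ closedBall 0 R) (i : Fin d) :
    partialDeriv R i (fun y => ∑ j ∈ s, w j y) x = ∑ j ∈ s, partialDeriv R i (w j) x := by
  rw [partialDeriv_eq hR hx (HasFDerivWithinAt.fun_sum fun j _ => (hw j).hasFDerivWithinAt hx) i]
  simp [partialDeriv]

theorem partialDeriv_coord_mul (hu : SmoothOnBall R u) (hx : x ∈ closedBall 0 R) (i j : Fin d) :
    partialDeriv R i (fun y => (y j : ℂ) * u y) x =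
      (if i = j then u x else 0) + (x j : ℂ) * partialDeriv R i u x := by
  have hc : HasFDerivWithinAt (fun y : Space d => (y j : ℂ))
      (Complex.ofRealCLM.comp (EuclideanSpace.proj j : Space d →L[ℝ] ℝ))
      (closedBall 0 R) x :=
    (Complex.ofRealCLM.comp (EuclideanSpace.proj j : Space d →L[ℝ] ℝ)).hasFDerivWithinAt
  rw [partialDeriv_eq hR hx (hc.fun_mul (hu.hasFDerivWithinAt hx)) i]
  by_cases h : i = j
  · subst h
    simp [partialDeriv, add_comm]
  · simp [partialDeriv, h, Ne.symm h]

theorem partialDeriv_partialDeriv_eq (hu : SmoothOnBall R u)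
    (hx : x ∈ closedBall 0 R) (i j : Fin d) :
    partialDeriv R i (partialDeriv R j u) x =
      fderivWithin ℝ (fderivWithin ℝ u (closedBall 0 R)) (closedBall 0 R) x
        (EuclideanSpace.single i 1) (EuclideanSpace.single j 1) := by
  have hD : SmoothOnBall R (fderivWithin ℝ u (closedBall 0 R)) :=
    hu.fderivWithin (uniqueDiffOn_closedBall hR) (by simp)
  have h := (hD.hasFDerivWithinAt hx).clm_apply
    (hasFDerivWithinAt_const (EuclideanSpace.single j (1 : ℝ)) x (closedBall 0 R))
  exact (partialDeriv_eq hR hx h i).trans (by simp)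

theorem partialDeriv_comm (hu : SmoothOnBall R u) (hx : x ∈ closedBall 0 R) (i j : Fin d) :
    partialDeriv R i (partialDeriv R j u) x = partialDeriv R j (partialDeriv R i u) x := by
  rw [partialDeriv_partialDeriv_eq hR hu hx, partialDeriv_partialDeriv_eq hR hu hx]
  -- Symmetry of the second derivative within a set holds at boundary points that are limits of
  -- interior points.
  have hcl : x ∈ closure (interior (closedBall (0 : Space d) R)) := by
    rw [interior_closedBall _ hR.ne', closure_ball _ hR.ne']
    exact hx
  exact (hu x hx).isSymmSndFDerivWithinAt (by simpa using two_le_infty)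
    (uniqueDiffOn_closedBall hR) hcl hx _ _

theorem laplace_eq_sum (hu : SmoothOnBall R u) (hx : x ∈ closedBall 0 R) :
    laplace R u x = ∑ i, partialDeriv R i (partialDeriv R i u) x := by
  rw [laplace, InnerProductSpace.laplacianWithin_eq_iteratedFDerivWithin_orthonormalBasis u
    (uniqueDiffOn_closedBall hR) hx (EuclideanSpace.basisFun (Fin d) ℝ)]
  refine Finset.sum_congr rfl fun i _ => ?_
  rw [partialDeriv_partialDeriv_eq hR hu hx,
    iteratedFDerivWithin_two_apply _ (uniqueDiffOn_closedBall hR) hx]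
  simp

theorem SmoothOnBall.laplace (hu : SmoothOnBall R u) : SmoothOnBall R (laplace R u) :=
  (ContDiffOn.sum fun i (_ : i ∈ Finset.univ) => (hu.partialDeriv hR i).partialDeriv hR i).congr
    fun _ hx => laplace_eq_sum hR hu hx

theorem laplace_add (hu : SmoothOnBall R u) (hv : SmoothOnBall R v) (hx : x ∈ closedBall 0 R) :
    laplace R (fun y => u y + v y) x = laplace R u x + laplace R v x :=
  ((hu x hx).of_le two_le_infty).laplacianWithin_add ((hv x hx).of_le two_le_infty)
    (uniqueDiffOn_closedBall hR) hx

theorem laplace_sub (hu : SmoothOnBall R u) (hv : SmoothOnBall R v) (hx : x ∈ closedBall 0 R) :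
    laplace R (fun y => u y - v y) x = laplace R u x - laplace R v x :=
  ((hu x hx).of_le two_le_infty).laplacianWithin_sub ((hv x hx).of_le two_le_infty)
    (uniqueDiffOn_closedBall hR) hx

theorem laplace_const_mul (hu : SmoothOnBall R u) (c : ℂ) (hx : x ∈ closedBall 0 R) :
    laplace R (fun y => c * u y) x = c * laplace R u x := by
  rw [laplace_eq_sum hR (contDiffOn_const.mul hu) hx, laplace_eq_sum hR hu hx, Finset.mul_sum]
  refine Finset.sum_congr rfl fun i _ => ?_
  rw [partialDeriv_congr i (fun y hy => partialDeriv_const_mul hR hu c hy i) hx,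
    partialDeriv_const_mul hR (hu.partialDeriv hR i) c hx]

theorem partialDeriv_eulerOp (hu : SmoothOnBall R u) (hx : x ∈ closedBall 0 R) (i : Fin d) :
    partialDeriv R i (eulerOp R u) x =
      partialDeriv R i u x + eulerOp R (partialDeriv R i u) x := by
  have h := partialDeriv_sum hR Finset.univ
    (fun j => (smoothOnBall_coord j).mul (hu.partialDeriv hR j)) hx i
  refine h.trans ?_
  have h2 : ∀ j, partialDeriv R i (fun y : Space d => (y j : ℂ) * partialDeriv R j u y) x =
      (if i = j then partialDeriv R j u x else 0)
        + (x j : ℂ) * partialDeriv R j (partialDeriv R i u) x := fun j => by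
    rw [partialDeriv_coord_mul hR (hu.partialDeriv hR j) hx, partialDeriv_comm hR hu hx]
  rw [Finset.sum_congr rfl fun j _ => h2 j, Finset.sum_add_distrib]
  simp [eulerOp]

theorem laplace_eulerOp (hu : SmoothOnBall R u) (hx : x ∈ closedBall 0 R) :
    laplace R (eulerOp R u) x = 2 * laplace R u x + eulerOp R (laplace R u) x := by
  have h1 : ∀ i, partialDeriv R i (partialDeriv R i (eulerOp R u)) x =
      2 * partialDeriv R i (partialDeriv R i u) x
        + eulerOp R (partialDeriv R i (partialDeriv R i u)) x := fun i => by
    rw [partialDeriv_congr i (fun y hy => partialDeriv_eulerOp hR hu hy i) hx,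
      partialDeriv_add hR (hu.partialDeriv hR i) ((hu.partialDeriv hR i).eulerOp hR) hx,
      partialDeriv_eulerOp hR (hu.partialDeriv hR i) hx]
    ring
  have h2 : ∀ j, partialDeriv R j (laplace R u) x =
      ∑ i, partialDeriv R j (partialDeriv R i (partialDeriv R i u)) x := fun j => by
    rw [partialDeriv_congr j (fun y hy => laplace_eq_sum hR hu hy) hx,
      partialDeriv_sum hR _ (fun i => (hu.partialDeriv hR i).partialDeriv hR i) hx]
  rw [laplace_eq_sum hR (hu.eulerOp hR) hx, Finset.sum_congr rfl fun i _ => h1 i,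
    Finset.sum_add_distrib, ← Finset.mul_sum, ← laplace_eq_sum hR hu hx]
  congr 1
  simp only [eulerOp, h2, Finset.mul_sum]
  exact Finset.sum_comm

end

/-! ### Commutation with L and algebra of the energy forms -/

variable {ε : ℕ → ℝ}

/-- Two pairs agree on the closed ball of radius `R`. -/
def EqOnBall (R : ℝ) (f g : Pair d) : Prop :=
  EqOn f.1 g.1 (closedBall 0 R) ∧ EqOn f.2 g.2 (closedBall 0 R)

theorem EqOnBall.refl (f : Pair d) : EqOnBall R f f := ⟨fun _ _ => rfl, fun _ _ => rfl⟩

theorem EqOnBall.opD (hR : 0 < R) {f g : Pair d} (h : EqOnBall R f g) (μ : Fin (d + 1)) :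
    EqOnBall R (opD R μ f) (opD R μ g) := by
  cases μ using Fin.cases with
  | zero => exact ⟨h.2, laplace_congr hR h.1⟩
  | succ i => exact ⟨partialDeriv_congr i h.1, partialDeriv_congr i h.2⟩

theorem IsSmoothPair.opD (hR : 0 < R) {f : Pair d} (hf : IsSmoothPair R f) (μ : Fin (d + 1)) :
    IsSmoothPair R (opD R μ f) := by
  cases μ using Fin.cases with
  | zero => exact ⟨hf.2, SmoothOnBall.laplace hR hf.1⟩
  | succ i => exact ⟨SmoothOnBall.partialDeriv hR hf.1 i, SmoothOnBall.partialDeriv hR hf.2 i⟩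

theorem IsSmoothPair.sub {f g : Pair d} (hf : IsSmoothPair R f) (hg : IsSmoothPair R g) :
    IsSmoothPair R (f - g) :=
  ⟨ContDiffOn.sub hf.1 hg.1, ContDiffOn.sub hf.2 hg.2⟩

theorem IsSmoothPair.waveOp (hR : 0 < R) {f : Pair d} (hf : IsSmoothPair R f) (p : ℝ) :
    IsSmoothPair R (waveOp p R f) :=
  ⟨((contDiffOn_const.mul hf.1).sub (SmoothOnBall.eulerOp hR hf.1)).add hf.2,
    ((SmoothOnBall.laplace hR hf.1).sub (contDiffOn_const.mul hf.2)).sub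
      (SmoothOnBall.eulerOp hR hf.2)⟩

theorem opD_sub (hR : 0 < R) {f g : Pair d} (hf : IsSmoothPair R f) (hg : IsSmoothPair R g)
    (μ : Fin (d + 1)) : EqOnBall R (opD R μ (f - g)) (opD R μ f - opD R μ g) := by
  cases μ using Fin.cases with
  | zero => exact ⟨fun _ _ => rfl, fun _ hx => laplace_sub hR hf.1 hg.1 hx⟩
  | succ i =>
    exact ⟨fun _ hx => partialDeriv_sub hR hf.1 hg.1 hx i,
      fun _ hx => partialDeriv_sub hR hf.2 hg.2 hx i⟩

/-- The commutation relation `D_μ L = L D_μ - D_μ`. -/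
theorem opD_waveOp (hR : 0 < R) {f : Pair d} (hf : IsSmoothPair R f) (p : ℝ) (μ : Fin (d + 1)) :
    EqOnBall R (opD R μ (waveOp p R f)) (waveOp p R (opD R μ f) - opD R μ f) := by
  obtain ⟨h1, h2⟩ := hf
  have s1 : SmoothOnBall R fun x => -(scalingExp p : ℂ) * f.1 x := contDiffOn_const.mul h1
  have s2 : SmoothOnBall R fun x => ((scalingExp p : ℂ) + 1) * f.2 x := contDiffOn_const.mul h2
  have e1 := SmoothOnBall.eulerOp hR h1
  have e2 := SmoothOnBall.eulerOp hR h2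
  have l1 := SmoothOnBall.laplace hR h1
  cases μ using Fin.cases with
  | zero =>
    refine ⟨fun x _ => ?_, fun x hx => ?_⟩
    · change laplace R f.1 x - ((scalingExp p : ℂ) + 1) * f.2 x - eulerOp R f.2 x =
        (-(scalingExp p : ℂ) * f.2 x - eulerOp R f.2 x + laplace R f.1 x) - f.2 x
      ring
    -- Of the 2Δ in the commutator of Δ with Λ, one Δ matches the extra 1 in the coefficient s + 1
    -- of the second row of L, and the other is the −D_0 f term.
    · change laplace R (fun x => (-(scalingExp p : ℂ) * f.1 x - eulerOp R f.1 x) + f.2 x) x =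
        (laplace R f.2 x - ((scalingExp p : ℂ) + 1) * laplace R f.1 x
          - eulerOp R (laplace R f.1) x) - laplace R f.1 x
      rw [laplace_add hR (s1.sub e1) h2 hx, laplace_sub hR s1 e1 hx, laplace_const_mul hR h1 _ hx,
        laplace_eulerOp hR h1 hx]
      ring
  | succ i =>
    refine ⟨fun x hx => ?_, fun x hx => ?_⟩
    · change partialDeriv R i (fun x => (-(scalingExp p : ℂ) * f.1 x - eulerOp R f.1 x) + f.2 x) x =
        (-(scalingExp p : ℂ) * partialDeriv R i f.1 x - eulerOp R (partialDeriv R i f.1) x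
          + partialDeriv R i f.2 x) - partialDeriv R i f.1 x
      rw [partialDeriv_add hR (s1.sub e1) h2 hx, partialDeriv_sub hR s1 e1 hx,
        partialDeriv_const_mul hR h1 _ hx, partialDeriv_eulerOp hR h1 hx]
      ring
    · have hl : laplace R (partialDeriv R i f.1) x = partialDeriv R i (laplace R f.1) x := by
        rw [laplace_eq_sum hR (SmoothOnBall.partialDeriv hR h1 i) hx,
          partialDeriv_congr i (fun y hy => laplace_eq_sum hR h1 hy) hx,
          partialDeriv_sum hR _ (fun j => SmoothOnBall.partialDeriv hR
            (SmoothOnBall.partialDeriv hR h1 j) j) hx]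
        refine Finset.sum_congr rfl fun j _ => ?_
        rw [partialDeriv_congr j (fun y hy => partialDeriv_comm hR h1 hy j i) hx,
          partialDeriv_comm hR (SmoothOnBall.partialDeriv hR h1 j) hx]
      change partialDeriv R i (fun x => (laplace R f.1 x - ((scalingExp p : ℂ) + 1) * f.2 x)
          - eulerOp R f.2 x) x =
        (laplace R (partialDeriv R i f.1) x - ((scalingExp p : ℂ) + 1) * partialDeriv R i f.2 x
          - eulerOp R (partialDeriv R i f.2) x) - partialDeriv R i f.2 x
      rw [partialDeriv_sub hR (l1.sub s2) e2 hx, partialDeriv_sub hR l1 s2 hx,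
        partialDeriv_const_mul hR h2 _ hx, partialDeriv_eulerOp hR h2 hx, hl]
      ring

theorem energyForm_one (f g : Pair d) : energyForm R ε 1 f g =
    (∫ x in ball (0 : Space d) R,
          ∑ i, starRingEnd ℂ (partialDeriv R i f.1 x) * partialDeriv R i g.1 x)
        + (∫ x in ball (0 : Space d) R, starRingEnd ℂ (f.2 x) * g.2 x)
        + ((2 * ε 1 / R : ℝ) : ℂ) * ∫ x, starRingEnd ℂ (f.1 x) * g.1 x ∂sphereMeasure d R := by
  rw [energyForm]

theorem energyForm_succ_of_lt {k : ℕ} (hk : 1 ≤ k) (h : ((k + 1 : ℕ) : ℝ) < (d : ℝ) / 2 + 1)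
    (f g : Pair d) : energyForm R ε (k + 1) f g =
      (∑ μ : Fin (d + 1), energyForm R ε k (opD R μ f) (opD R μ g))
          + ((2 * ε (k + 1) / R : ℝ) : ℂ) *
              ∫ x, starRingEnd ℂ (f.1 x) * g.1 x ∂sphereMeasure d R := by
  obtain ⟨k, rfl⟩ : ∃ m, k = m + 1 := ⟨k - 1, by omega⟩
  rw [energyForm, if_pos h]

theorem energyForm_succ_of_le {k : ℕ} (hk : 1 ≤ k) (h : (d : ℝ) / 2 + 1 ≤ ((k + 1 : ℕ) : ℝ))
    (f g : Pair d) : energyForm R ε (k + 1) f g =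
      (∑ μ : Fin (d + 1), energyForm R ε k (opD R μ f) (opD R μ g)) + energyForm R ε k f g := by
  obtain ⟨k, rfl⟩ : ∃ m, k = m + 1 := ⟨k - 1, by omega⟩
  rw [energyForm, if_neg h.not_gt]

theorem sphere_pairing_congr (hR : 0 < R) {f f' g g' : Space d → ℂ}
    (hf : EqOn f f' (closedBall 0 R)) (hg : EqOn g g' (closedBall 0 R)) :
    ∫ x, starRingEnd ℂ (f x) * g x ∂sphereMeasure d R =
      ∫ x, starRingEnd ℂ (f' x) * g' x ∂sphereMeasure d R := by
  refine integral_congr_ae (ae_sphereMeasure hR fun x hx => ?_)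
  have hx' : x ∈ closedBall (0 : Space d) R := by simp [hx]
  simp only [hf hx', hg hx']

/-- The identities for D_μ hold only on the closed ball, while a pair is arbitrary outside; this
permits substituting them into the forms. -/
theorem energyForm_congr (hR : 0 < R) (k : ℕ) : ∀ {f f' g g' : Pair d}, EqOnBall R f f' →
    EqOnBall R g g' → energyForm R ε k f g = energyForm R ε k f' g' := by
  induction k with
  | zero => intros; rfl
  | succ k ih =>
    intro f f' g g' hf hg
    have hsum : ∑ μ : Fin (d + 1), energyForm R ε k (opD R μ f) (opD R μ g) =
        ∑ μ : Fin (d + 1), energyForm R ε k (opD R μ f') (opD R μ g') :=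
      Finset.sum_congr rfl fun μ _ => ih (hf.opD hR μ) (hg.opD hR μ)
    rcases Nat.eq_zero_or_pos k with rfl | hk
    · rw [zero_add, energyForm_one, energyForm_one, sphere_pairing_congr hR hf.1 hg.1]
      congr 2
      · refine setIntegral_congr_fun measurableSet_ball fun x hx => ?_
        have hx' := ball_subset_closedBall hx
        simp only [partialDeriv_congr _ hf.1 hx', partialDeriv_congr _ hg.1 hx']
      · refine setIntegral_congr_fun measurableSet_ball fun x hx => ?_
        have hx' := ball_subset_closedBall hx
        simp only [hf.2 hx', hg.2 hx']
    · rcases lt_or_ge ((k + 1 : ℕ) : ℝ) ((d : ℝ) / 2 + 1) with h | h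
      · rw [energyForm_succ_of_lt hk h, energyForm_succ_of_lt hk h, hsum,
          sphere_pairing_congr hR hf.1 hg.1]
      · rw [energyForm_succ_of_le hk h, energyForm_succ_of_le hk h, hsum, ih hf hg]

theorem continuousOn_pairing {u v : Space d → ℂ} (hu : SmoothOnBall R u) (hv : SmoothOnBall R v) :
    ContinuousOn (fun x => starRingEnd ℂ (u x) * v x) (closedBall 0 R) :=
  (Complex.continuous_conj.comp_continuousOn hu.continuousOn).mul hv.continuousOn

theorem continuousOn_grad_pairing (hR : 0 < R) {u v : Space d → ℂ} (hu : SmoothOnBall R u)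
    (hv : SmoothOnBall R v) :
    ContinuousOn (fun x => ∑ i, starRingEnd ℂ (partialDeriv R i u x) * partialDeriv R i v x)
      (closedBall 0 R) :=
  continuousOn_finsetSum _ fun i _ =>
    continuousOn_pairing (hu.partialDeriv hR i) (hv.partialDeriv hR i)

theorem sphere_pairing_sub_left (hR : 0 < R) {f g h : Space d → ℂ} (hf : SmoothOnBall R f)
    (hg : SmoothOnBall R g) (hh : SmoothOnBall R h) :
    ∫ x, starRingEnd ℂ (f x - g x) * h x ∂sphereMeasure d R =
      (∫ x, starRingEnd ℂ (f x) * h x ∂sphereMeasure d R)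
        - ∫ x, starRingEnd ℂ (g x) * h x ∂sphereMeasure d R := by
  rw [← integral_sub (integrable_sphereMeasure hR (continuousOn_pairing hf hh))
    (integrable_sphereMeasure hR (continuousOn_pairing hg hh))]
  simp only [map_sub, sub_mul]

theorem energyForm_sub_left (hR : 0 < R) (k : ℕ) : ∀ {f g h : Pair d}, IsSmoothPair R f →
    IsSmoothPair R g → IsSmoothPair R h →
    energyForm R ε k (f - g) h = energyForm R ε k f h - energyForm R ε k g h := by
  induction k with
  | zero => intros; simp [energyForm]
  | succ k ih =>
    intro f g h hf hg hh
    have hsum : ∑ μ : Fin (d + 1), energyForm R ε k (opD R μ (f - g)) (opD R μ h) =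
        (∑ μ : Fin (d + 1), energyForm R ε k (opD R μ f) (opD R μ h))
          - ∑ μ : Fin (d + 1), energyForm R ε k (opD R μ g) (opD R μ h) := by
      rw [← Finset.sum_sub_distrib]
      refine Finset.sum_congr rfl fun μ _ => ?_
      rw [energyForm_congr hR k (opD_sub hR hf hg μ) (EqOnBall.refl _),
        ih (hf.opD hR μ) (hg.opD hR μ) (hh.opD hR μ)]
    have hsph : ∫ x, starRingEnd ℂ ((f - g).1 x) * h.1 x ∂sphereMeasure d R =
      (∫ x, starRingEnd ℂ (f.1 x) * h.1 x ∂sphereMeasure d R)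
        - ∫ x, starRingEnd ℂ (g.1 x) * h.1 x ∂sphereMeasure d R :=
      sphere_pairing_sub_left hR hf.1 hg.1 hh.1
    rcases Nat.eq_zero_or_pos k with rfl | hk
    · rw [zero_add, energyForm_one, energyForm_one, energyForm_one, hsph]
      have hgrad : ∫ x in ball (0 : Space d) R,
            ∑ i, starRingEnd ℂ (partialDeriv R i (f - g).1 x) * partialDeriv R i h.1 x =
          (∫ x in ball (0 : Space d) R,
            ∑ i, starRingEnd ℂ (partialDeriv R i f.1 x) * partialDeriv R i h.1 x)
          - ∫ x in ball (0 : Space d) R,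
            ∑ i, starRingEnd ℂ (partialDeriv R i g.1 x) * partialDeriv R i h.1 x := by
        rw [← integral_sub (integrableOn_ball (continuousOn_grad_pairing hR hf.1 hh.1))
          (integrableOn_ball (continuousOn_grad_pairing hR hg.1 hh.1))]
        refine setIntegral_congr_fun measurableSet_ball fun x hx => ?_
        have hx' := ball_subset_closedBall hx
        have h1 : ∀ i, partialDeriv R i (f - g).1 x
            = partialDeriv R i f.1 x - partialDeriv R i g.1 x :=
          fun i => partialDeriv_sub hR hf.1 hg.1 hx' i
        simp only [h1, map_sub, sub_mul, Finset.sum_sub_distrib]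
      have hsnd : ∫ x in ball (0 : Space d) R, starRingEnd ℂ ((f - g).2 x) * h.2 x =
          (∫ x in ball (0 : Space d) R, starRingEnd ℂ (f.2 x) * h.2 x)
          - ∫ x in ball (0 : Space d) R, starRingEnd ℂ (g.2 x) * h.2 x := by
        rw [← integral_sub (integrableOn_ball (continuousOn_pairing hf.2 hh.2))
          (integrableOn_ball (continuousOn_pairing hg.2 hh.2))]
        simp only [Prod.snd_sub, Pi.sub_apply, map_sub, sub_mul]
      rw [hgrad, hsnd]
      ring
    · rcases lt_or_ge ((k + 1 : ℕ) : ℝ) ((d : ℝ) / 2 + 1) with hlt | hle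
      · rw [energyForm_succ_of_lt hk hlt, energyForm_succ_of_lt hk hlt,
          energyForm_succ_of_lt hk hlt, hsum, hsph]
        ring
      · rw [energyForm_succ_of_le hk hle, energyForm_succ_of_le hk hle,
          energyForm_succ_of_le hk hle, hsum, ih hf hg hh]
        ring

/-- The subtracted term is the gain of one in the decay rate at each order. -/
theorem energyForm_opD_waveOp (hR : 0 < R) {f : Pair d} (hf : IsSmoothPair R f) (p : ℝ) (k : ℕ)
    (μ : Fin (d + 1)) :
    energyForm R ε k (opD R μ (waveOp p R f)) (opD R μ f) =
      energyForm R ε k (waveOp p R (opD R μ f)) (opD R μ f)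
        - energyForm R ε k (opD R μ f) (opD R μ f) := by
  have h := hf.opD hR μ
  rw [energyForm_congr hR k (opD_waveOp hR hf p μ) (EqOnBall.refl _),
    energyForm_sub_left hR k (h.waveOp hR p) h h]

/-! ### Real parts and positivity -/

theorem re_integral_pairing {α : Type*} [MeasurableSpace α] {m : Measure α} {u v : α → ℂ}
    (h : Integrable (fun x => starRingEnd ℂ (u x) * v x) m) :
    (∫ x, starRingEnd ℂ (u x) * v x ∂m).re = ∫ x, inner ℝ (u x) (v x) ∂m := by
  simp only [Complex.inner, mul_comm _ (starRingEnd ℂ _)]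
  exact (integral_re h).symm

theorem re_integral_sphere (hR : 0 < R) {u v : Space d → ℂ} (hu : SmoothOnBall R u)
    (hv : SmoothOnBall R v) :
    (∫ x, starRingEnd ℂ (u x) * v x ∂sphereMeasure d R).re =
      ∫ x, inner ℝ (u x) (v x) ∂sphereMeasure d R :=
  re_integral_pairing (integrable_sphereMeasure hR (continuousOn_pairing hu hv))

/-- The squared norm `∫ |f₁|²` on the boundary sphere. -/
def boundarySq (R : ℝ) (f : Pair d) : ℝ := ∫ x, ‖f.1 x‖ ^ 2 ∂sphereMeasure d R

theorem re_energyForm_one (hR : 0 < R) {f g : Pair d} (hf : IsSmoothPair R f)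
    (hg : IsSmoothPair R g) : (energyForm R ε 1 f g).re =
      (∫ x in ball (0 : Space d) R,
          ((∑ i, inner ℝ (partialDeriv R i f.1 x) (partialDeriv R i g.1 x))
            + inner ℝ (f.2 x) (g.2 x)))
        + 2 * ε 1 / R * ∫ x, inner ℝ (f.1 x) (g.1 x) ∂sphereMeasure d R := by
  have i1 := integrableOn_ball (continuousOn_grad_pairing hR hf.1 hg.1)
  have i2 := integrableOn_ball (continuousOn_pairing hf.2 hg.2)
  rw [energyForm_one, Complex.add_re, Complex.re_ofReal_mul, re_integral_sphere hR hf.1 hg.1,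
    ← integral_add i1 i2]
  congr 1
  refine (integral_re (i1.add i2)).symm.trans ?_
  simp [Complex.inner, mul_comm]

theorem re_energyForm_succ_of_lt (hR : 0 < R) {k : ℕ} (hk : 1 ≤ k)
    (h : ((k + 1 : ℕ) : ℝ) < (d : ℝ) / 2 + 1) {f g : Pair d} (hf : IsSmoothPair R f)
    (hg : IsSmoothPair R g) : (energyForm R ε (k + 1) f g).re =
      (∑ μ : Fin (d + 1), (energyForm R ε k (opD R μ f) (opD R μ g)).re)
          + 2 * ε (k + 1) / R * ∫ x, inner ℝ (f.1 x) (g.1 x) ∂sphereMeasure d R := by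
  rw [energyForm_succ_of_lt hk h, Complex.add_re, Complex.re_ofReal_mul,
    re_integral_sphere hR hf.1 hg.1, Complex.re_sum]

theorem re_energyForm_succ_of_le {k : ℕ} (hk : 1 ≤ k)
    (h : (d : ℝ) / 2 + 1 ≤ ((k + 1 : ℕ) : ℝ)) (f g : Pair d) :
    (energyForm R ε (k + 1) f g).re =
      (∑ μ : Fin (d + 1), (energyForm R ε k (opD R μ f) (opD R μ g)).re)
        + (energyForm R ε k f g).re := by
  rw [energyForm_succ_of_le hk h, Complex.add_re, Complex.re_sum]

theorem re_energyForm_self_nonneg (hR : 0 < R)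
    (hε : ∀ j : ℕ, 1 ≤ j → (j : ℝ) < (d : ℝ) / 2 + 1 → 0 < ε j) (k : ℕ) :
    ∀ {f : Pair d}, 1 ≤ d → IsSmoothPair R f → 0 ≤ (energyForm R ε k f f).re := by
  induction k with
  | zero => intros; simp [energyForm]
  | succ k ih =>
    intro f hd hf
    have hsum : 0 ≤ ∑ μ : Fin (d + 1), (energyForm R ε k (opD R μ f) (opD R μ f)).re :=
      Finset.sum_nonneg fun μ _ => ih hd (hf.opD hR μ)
    have hsph : 0 ≤ ∫ x, inner ℝ (f.1 x) (f.1 x) ∂sphereMeasure d R :=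
      integral_nonneg fun x => real_inner_self_nonneg
    rcases Nat.eq_zero_or_pos k with rfl | hk
    · have h1 : (1 : ℝ) ≤ d := by exact_mod_cast hd
      have := hε 1 le_rfl (by push_cast; linarith)
      rw [zero_add, re_energyForm_one hR hf hf]
      refine add_nonneg (integral_nonneg fun x => ?_) (by positivity)
      exact add_nonneg (Finset.sum_nonneg fun i _ => real_inner_self_nonneg)
        real_inner_self_nonneg
    · rcases lt_or_ge ((k + 1 : ℕ) : ℝ) ((d : ℝ) / 2 + 1) with h | h
      · have := hε (k + 1) (by omega) h
        rw [re_energyForm_succ_of_lt hR hk h hf hf]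
        positivity
      · rw [re_energyForm_succ_of_le hk h]
        exact add_nonneg hsum (ih hd hf)

/-- The rest of the form is nonnegative. This absorbs the boundary term when its coefficient in the
low-order estimate is nonnegative. -/
theorem boundarySq_le_energyForm (hR : 0 < R) (hd : 1 ≤ d)
    (hε : ∀ j : ℕ, 1 ≤ j → (j : ℝ) < (d : ℝ) / 2 + 1 → 0 < ε j) {k : ℕ} (hk : 1 ≤ k)
    (hkd : (k : ℝ) < (d : ℝ) / 2 + 1) {f : Pair d} (hf : IsSmoothPair R f) :
    2 * ε k / R * boundarySq R f ≤ (energyForm R ε k f f).re := by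
  have hb : ∫ x, inner ℝ (f.1 x) (f.1 x) ∂sphereMeasure d R = boundarySq R f := by
    simp only [real_inner_self_eq_norm_sq, boundarySq]
  obtain ⟨k, rfl⟩ : ∃ m, k = m + 1 := ⟨k - 1, by omega⟩
  rcases Nat.eq_zero_or_pos k with rfl | hk'
  · rw [zero_add, re_energyForm_one hR hf hf, hb]
    refine le_add_of_nonneg_left (integral_nonneg fun x => ?_)
    exact add_nonneg (Finset.sum_nonneg fun i _ => real_inner_self_nonneg) real_inner_self_nonneg
  · rw [re_energyForm_succ_of_lt hR hk' hkd hf hf, hb]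
    exact le_add_of_nonneg_left
      (Finset.sum_nonneg fun μ _ => re_energyForm_self_nonneg hR hε k hd (hf.opD hR μ))

/-! ### First-order energy estimate -/

/-- The energy density `|∇f₁|² + |f₂|²`. -/
def energyDensity (R : ℝ) (f : Pair d) : Space d → ℝ :=
  fun x => (∑ i, ‖partialDeriv R i f.1 x‖ ^ 2) + ‖f.2 x‖ ^ 2

theorem IsSmoothPair.energyDensity (hR : 0 < R) {f : Pair d} (hf : IsSmoothPair R f) :
    SmoothOnBall R (energyDensity R f) :=
  (ContDiffOn.sum fun i _ => (SmoothOnBall.partialDeriv hR hf.1 i).norm_sq ℝ).add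
    (ContDiffOn.norm_sq ℝ hf.2)

theorem eulerOp_eq_fderivWithin (u : Space d → ℂ) (x : Space d) :
    eulerOp R u x = fderivWithin ℝ u (closedBall 0 R) x x := by
  have hx : x = ∑ i, x i • EuclideanSpace.single i (1 : ℝ) := by
    have := (EuclideanSpace.basisFun (Fin d) ℝ).sum_repr x
    simpa using this.symm
  conv_rhs => rw [hx, map_sum]
  rw [← hx]
  simp [eulerOp, partialDeriv]

theorem norm_eulerOp_sq_le (u : Space d → ℂ) (x : Space d) :
    ‖eulerOp R u x‖ ^ 2 ≤ ‖x‖ ^ 2 * ∑ i, ‖partialDeriv R i u x‖ ^ 2 := by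
  have h1 : ‖eulerOp R u x‖ ≤ ∑ i, |x i| * ‖partialDeriv R i u x‖ :=
    (norm_sum_le _ _).trans_eq (by simp)
  calc ‖eulerOp R u x‖ ^ 2 ≤ (∑ i, |x i| * ‖partialDeriv R i u x‖) ^ 2 := by gcongr
    _ ≤ (∑ i, |x i| ^ 2) * ∑ i, ‖partialDeriv R i u x‖ ^ 2 :=
      Finset.sum_mul_sq_le_sq_mul_sq _ _ _
    _ = _ := by simp [EuclideanSpace.real_norm_sq_eq]

theorem fderivWithin_energyDensity_self (hR : 0 < R) {f : Pair d} (hf : IsSmoothPair R f)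
    {x : Space d} (hx : x ∈ closedBall 0 R) :
    fderivWithin ℝ (energyDensity R f) (closedBall 0 R) x x =
      2 * ((∑ i, inner ℝ (eulerOp R (partialDeriv R i f.1) x) (partialDeriv R i f.1 x))
        + inner ℝ (eulerOp R f.2 x) (f.2 x)) := by
  have h : HasFDerivWithinAt (energyDensity R f) _ (closedBall 0 R) x :=
    (HasFDerivWithinAt.fun_sum fun i (_ : i ∈ Finset.univ) =>
      ((SmoothOnBall.partialDeriv hR hf.1 i).hasFDerivWithinAt hx).norm_sq).fun_add
      ((SmoothOnBall.hasFDerivWithinAt hf.2 hx).norm_sq)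
  rw [h.fderivWithin (uniqueDiffOn_closedBall hR x hx)]
  simp only [eulerOp_eq_fderivWithin, add_apply, sum_apply, smul_apply,
    ContinuousLinearMap.comp_apply, innerSL_apply_apply, nsmul_eq_mul, Nat.cast_ofNat,
    real_inner_comm, mul_add, Finset.mul_sum]

theorem fderivWithin_inner_apply (hR : 0 < R) {u v : Space d → ℂ} (hu : SmoothOnBall R u)
    (hv : SmoothOnBall R v) {x : Space d} (hx : x ∈ closedBall 0 R) (i : Fin d) :
    fderivWithin ℝ (fun y => inner ℝ (u y) (v y)) (closedBall 0 R) x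
        (EuclideanSpace.single i 1) =
      inner ℝ (u x) (partialDeriv R i v x) + inner ℝ (partialDeriv R i u x) (v x) := by
  rw [((hu.hasFDerivWithinAt hx).inner ℝ (hv.hasFDerivWithinAt hx)).fderivWithin
    (uniqueDiffOn_closedBall hR x hx)]
  simp [partialDeriv, fderivInnerCLM_apply]

theorem waveOp_fst (p : ℝ) (f : Pair d) (x : Space d) : (waveOp p R f).1 x =
    -(scalingExp p) • f.1 x - eulerOp R f.1 x + f.2 x := by
  simp [waveOp, eulerOp]

theorem waveOp_snd (p : ℝ) (f : Pair d) (x : Space d) : (waveOp p R f).2 x =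
    laplace R f.1 x - (scalingExp p + 1) • f.2 x - eulerOp R f.2 x := by
  simp [waveOp, eulerOp]

/-- With e the energy density, the Λ terms give −½ x·∇e, which is rewritten as −½ div(x e) + (d/2)
e. The wave terms combine to the divergence of Re(f̄₂∇f₁). Both divergences then become boundary
integrals. -/
theorem energy_integrand_eq (hR : 0 < R) {f : Pair d} (hf : IsSmoothPair R f) (p : ℝ)
    {x : Space d} (hx : x ∈ closedBall 0 R) :
    (∑ i, inner ℝ (partialDeriv R i (waveOp p R f).1 x) (partialDeriv R i f.1 x))
        + inner ℝ ((waveOp p R f).2 x) (f.2 x) =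
      (((d : ℝ) / 2 - scalingExp p - 1) * energyDensity R f x
        + (-(1 / 2)) * (d * energyDensity R f x
          + fderivWithin ℝ (energyDensity R f) (closedBall 0 R) x x))
      + ∑ i, fderivWithin ℝ (fun y => inner ℝ (f.2 y) (partialDeriv R i f.1 y))
          (closedBall 0 R) x (EuclideanSpace.single i 1) := by
  have h1 : ∀ i, partialDeriv R i (waveOp p R f).1 x =
      (-(scalingExp p) • partialDeriv R i f.1 x - eulerOp R (partialDeriv R i f.1) x
        + partialDeriv R i f.2 x) - partialDeriv R i f.1 x := fun i => by
    have := (opD_waveOp hR hf p i.succ).1 hx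
    rw [Prod.fst_sub, Pi.sub_apply, waveOp_fst] at this
    exact this
  have h2 : ∀ i, fderivWithin ℝ (fun y => inner ℝ (f.2 y) (partialDeriv R i f.1 y))
          (closedBall 0 R) x (EuclideanSpace.single i 1) =
        inner ℝ (f.2 x) (partialDeriv R i (partialDeriv R i f.1) x)
          + inner ℝ (partialDeriv R i f.2 x) (partialDeriv R i f.1 x) := fun i =>
    fderivWithin_inner_apply hR hf.2 (SmoothOnBall.partialDeriv hR hf.1 i) hx i
  simp only [h1, h2, waveOp_snd, fderivWithin_energyDensity_self hR hf hx,
    laplace_eq_sum hR hf.1 hx, energyDensity, inner_sub_left, inner_add_left,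
    real_inner_smul_left, real_inner_self_eq_norm_sq, Finset.sum_add_distrib,
    Finset.sum_sub_distrib, ← Finset.mul_sum, sum_inner]
  rw [Finset.sum_congr rfl fun i _ => real_inner_comm (f.2 x)
    (partialDeriv R i (partialDeriv R i f.1) x)]
  ring

/-- The energy identity at first order. -/
theorem re_energyForm_one_waveOp (hd : 1 ≤ d) (hR : 0 < R) {f : Pair d} (hf : IsSmoothPair R f)
    (p : ℝ) : (energyForm R ε 1 (waveOp p R f) f).re =
      ((d : ℝ) / 2 - scalingExp p - 1) * (∫ x in ball (0 : Space d) R, energyDensity R f x)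
      + ∫ x, (-(R / 2) * energyDensity R f x + R⁻¹ * inner ℝ (f.2 x) (eulerOp R f.1 x)
          + 2 * ε 1 / R * inner ℝ ((waveOp p R f).1 x) (f.1 x)) ∂sphereMeasure d R := by
  have he := hf.energyDensity hR
  have he1 : ContDiffOn ℝ 1 (energyDensity R f) (closedBall 0 R) := he.of_le (by simp)
  have hw := hf.waveOp hR p
  have hV : ∀ i, SmoothOnBall R fun y => (inner ℝ (f.2 y) (partialDeriv R i f.1 y) : ℝ) :=
    fun i => ContDiffOn.inner ℝ hf.2 (SmoothOnBall.partialDeriv hR hf.1 i)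
  have hV1 : ∀ i, ContDiffOn ℝ 1 (fun y => (inner ℝ (f.2 y) (partialDeriv R i f.1 y) : ℝ))
      (closedBall 0 R) := fun i => (hV i).of_le (by simp)
  rw [re_energyForm_one hR hw hf, setIntegral_congr_fun measurableSet_ball
    fun x hx => energy_integrand_eq hR hf p (ball_subset_closedBall hx)]
  have i1 : IntegrableOn (energyDensity R f) (ball 0 R) := integrableOn_ball he.continuousOn
  have i2 : IntegrableOn (fun x => d * energyDensity R f x
      + fderivWithin ℝ (energyDensity R f) (closedBall 0 R) x x) (ball 0 R) :=
    integrableOn_ball ((continuousOn_const.mul he.continuousOn).add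
      ((continuousOn_fderivWithin_closedBall hR he1).clm_apply continuousOn_id))
  have i3 : ∀ i, IntegrableOn (fun x => fderivWithin ℝ (fun y =>
      (inner ℝ (f.2 y) (partialDeriv R i f.1 y) : ℝ)) (closedBall 0 R) x
        (EuclideanSpace.single i 1)) (ball 0 R) := fun i =>
    integrableOn_ball
      ((continuousOn_fderivWithin_closedBall hR (hV1 i)).clm_apply continuousOn_const)
  have i4 : IntegrableOn (fun x => ∑ i, fderivWithin ℝ (fun y =>
      (inner ℝ (f.2 y) (partialDeriv R i f.1 y) : ℝ)) (closedBall 0 R) x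
        (EuclideanSpace.single i 1)) (ball 0 R) := integrable_finsetSum _ fun i _ => i3 i
  have j1 := integrable_sphereMeasure hR he.continuousOn
  have j2 : Integrable (fun x => (inner ℝ (f.2 x) (eulerOp R f.1 x) : ℝ)) (sphereMeasure d R) :=
    integrable_sphereMeasure hR
      (ContDiffOn.inner ℝ hf.2 (SmoothOnBall.eulerOp hR hf.1)).continuousOn
  have j3 : Integrable (fun x => (inner ℝ ((waveOp p R f).1 x) (f.1 x) : ℝ))
      (sphereMeasure d R) :=
    integrable_sphereMeasure hR (ContDiffOn.inner ℝ hw.1 hf.1).continuousOn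
  have hgreen : ∑ i, ∫ x in ball (0 : Space d) R, fderivWithin ℝ (fun y =>
      (inner ℝ (f.2 y) (partialDeriv R i f.1 y) : ℝ)) (closedBall 0 R) x
        (EuclideanSpace.single i 1) =
      R⁻¹ * ∫ x, inner ℝ (f.2 x) (eulerOp R f.1 x) ∂sphereMeasure d R := by
    -- The outward normal is x/R, so the flux of Re(f̄₂∇f₁) involves Λf₁/R.
    simp only [integral_ball_fderivWithin hd hR (hV1 _)]
    rw [← Finset.mul_sum, ← integral_finsetSum]
    · congr 2
      ext x
      simp only [eulerOp, inner_sum, ← Complex.real_smul, real_inner_smul_right]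
      simp [EuclideanSpace.inner_single_right]
    · intro i _
      exact integrable_sphereMeasure hR
        ((continuous_id.inner continuous_const).continuousOn.mul (hV i).continuousOn)
  have j12 : Integrable (fun x => -(R / 2) * energyDensity R f x
      + R⁻¹ * inner ℝ (f.2 x) (eulerOp R f.1 x)) (sphereMeasure d R) :=
    (j1.const_mul _).add (j2.const_mul _)
  have i12 : IntegrableOn (fun x => ((d : ℝ) / 2 - scalingExp p - 1) * energyDensity R f x
        + (-(1 / 2)) * (d * energyDensity R f x
          + fderivWithin ℝ (energyDensity R f) (closedBall 0 R) x x)) (ball 0 R) :=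
    (i1.const_mul _).add (i2.const_mul _)
  rw [integral_add i12 i4, integral_add (i1.const_mul _) (i2.const_mul _), integral_const_mul,
    integral_const_mul, integral_ball_radial hd hR he1, integral_finsetSum _ fun i _ => i3 i,
    hgreen, integral_add j12 (j3.const_mul _), integral_add (j1.const_mul _) (j2.const_mul _),
    integral_const_mul, integral_const_mul, integral_const_mul]
  ring

/-- Here a, b, c, G stand for f₂, Λf₁, f₁, |∇f₁|² at a boundary point. After multiplication by 2R,
the right side minus the left is at least ‖a − b − 2ηc‖², by the hypothesis on b and R ≥ 1. -/
theorem boundary_quadratic_nonpos {R s η G : ℝ} (hR : 1 ≤ R) {a b c : ℂ}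
    (hb : ‖b‖ ^ 2 ≤ R ^ 2 * G) :
    -(R / 2) * (G + ‖a‖ ^ 2) + R⁻¹ * inner ℝ a b + 2 * η / R * inner ℝ (-s • c - b + a) c
      ≤ 2 * η / R * ((η - s) * ‖c‖ ^ 2) := by
  have h0 : 0 < R := by linarith
  have hsq : ‖a - b - (2 * η) • c‖ ^ 2 = ‖a‖ ^ 2 + ‖b‖ ^ 2 + 4 * η ^ 2 * ‖c‖ ^ 2
      - 2 * inner ℝ a b - 4 * η * inner ℝ a c + 4 * η * inner ℝ b c := by
    rw [norm_sub_sq_real, norm_sub_sq_real, inner_sub_left, real_inner_smul_right,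
      real_inner_smul_right, norm_smul, mul_pow, Real.norm_eq_abs, sq_abs]
    ring
  have hin : inner ℝ (-s • c - b + a) c = -s * ‖c‖ ^ 2 - inner ℝ b c + inner ℝ a c := by
    rw [inner_add_left, inner_sub_left, real_inner_smul_left, real_inner_self_eq_norm_sq]
  have hn := sq_nonneg ‖a - b - (2 * η) • c‖
  have ha : ‖a‖ ^ 2 ≤ R ^ 2 * ‖a‖ ^ 2 :=
    le_mul_of_one_le_left (sq_nonneg _) (one_le_pow₀ hR)
  rw [hin, ← sub_nonneg]
  have : 2 * η / R * ((η - s) * ‖c‖ ^ 2) - (-(R / 2) * (G + ‖a‖ ^ 2) + R⁻¹ * inner ℝ a b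
      + 2 * η / R * (-s * ‖c‖ ^ 2 - inner ℝ b c + inner ℝ a c)) =
      (R ^ 2 * G + R ^ 2 * ‖a‖ ^ 2 - 2 * inner ℝ a b - 4 * η * inner ℝ a c + 4 * η * inner ℝ b c
        + 4 * η ^ 2 * ‖c‖ ^ 2) / (2 * R) := by
    field_simp
    ring
  rw [this]
  refine div_nonneg ?_ (by positivity)
  linarith

theorem re_energyForm_one_waveOp_le (hd : 1 ≤ d) (hR : 1 ≤ R) {f : Pair d}
    (hf : IsSmoothPair R f) (p : ℝ) : (energyForm R ε 1 (waveOp p R f) f).re ≤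
      ((d : ℝ) / 2 - scalingExp p - 1) * (energyForm R ε 1 f f).re
        + (-((d : ℝ) / 2) + 1 + ε 1) * (2 * ε 1 / R * boundarySq R f) := by
  have h0 : 0 < R := by linarith
  have he := hf.energyDensity h0
  have hw := hf.waveOp h0 p
  have hself : (energyForm R ε 1 f f).re =
      (∫ x in ball (0 : Space d) R, energyDensity R f x) + 2 * ε 1 / R * boundarySq R f := by
    rw [re_energyForm_one h0 hf hf]
    simp only [real_inner_self_eq_norm_sq, boundarySq, energyDensity]
  have hbd : ∫ x, (-(R / 2) * energyDensity R f x + R⁻¹ * inner ℝ (f.2 x) (eulerOp R f.1 x)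
          + 2 * ε 1 / R * inner ℝ ((waveOp p R f).1 x) (f.1 x)) ∂sphereMeasure d R ≤
      ∫ x, 2 * ε 1 / R * ((ε 1 - scalingExp p) * ‖f.1 x‖ ^ 2) ∂sphereMeasure d R := by
    refine integral_mono_ae (integrable_sphereMeasure h0 ?_) (integrable_sphereMeasure h0 ?_)
      (ae_sphereMeasure h0 fun x hx => ?_)
    · exact ((continuousOn_const.mul he.continuousOn).add (continuousOn_const.mul
        (ContDiffOn.inner ℝ hf.2 (SmoothOnBall.eulerOp h0 hf.1)).continuousOn)).add
        (continuousOn_const.mul (ContDiffOn.inner ℝ hw.1 hf.1).continuousOn)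
    · exact continuousOn_const.mul (continuousOn_const.mul (hf.1.continuousOn.norm.pow 2))
    · simp only [waveOp_fst]
      refine boundary_quadratic_nonpos hR ?_
      rw [← hx]
      exact norm_eulerOp_sq_le f.1 x
  rw [integral_const_mul, integral_const_mul] at hbd
  change _ ≤ 2 * ε 1 / R * ((ε 1 - scalingExp p) * boundarySq R f) at hbd
  -- The rates match because ε₁ − s = (d/2 − s − 1) + (−d/2 + 1 + ε₁).
  rw [re_energyForm_one_waveOp hd h0 hf, hself]
  linarith

/-! ### Boundary weights and induction on the order -/

/-- The choice of boundary weights: `ε_j = (ε₁ / (16 R²))^(j-1) ε₁ ∏_{i<j} (d/2 - i - ε₁)`. -/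
def IsBoundaryWeight (d : ℕ) (R : ℝ) (ε : ℕ → ℝ) : Prop :=
  ∀ j : ℕ, 2 ≤ j → (j : ℝ) < (d : ℝ) / 2 + 1 →
    ε j = (ε 1 / (16 * R ^ 2)) ^ (j - 1) * ε 1 *
      ∏ i ∈ Finset.Icc 1 (j - 1), ((d : ℝ) / 2 - (i : ℝ) - ε 1)

/-- As 2i and d are integers, i < d/2 leaves a gap of at least 1/2; hence the restriction ε₁ < 1/2.
-/
theorem half_sub_pos {η : ℝ} (hη : η < 1 / 2) {i : ℕ} (hi : (i : ℝ) < (d : ℝ) / 2) :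
    0 < (d : ℝ) / 2 - i - η := by
  have h1 : 2 * i < d := by
    have : (2 * i : ℝ) < d := by linarith
    exact_mod_cast this
  have h2 : (2 * i + 1 : ℝ) ≤ d := by exact_mod_cast h1
  linarith

theorem IsBoundaryWeight.eq (hε : IsBoundaryWeight d R ε) {j : ℕ} (hj : 1 ≤ j)
    (hjd : (j : ℝ) < (d : ℝ) / 2 + 1) : ε j = (ε 1 / (16 * R ^ 2)) ^ (j - 1) * ε 1 *
      ∏ i ∈ Finset.Icc 1 (j - 1), ((d : ℝ) / 2 - (i : ℝ) - ε 1) := by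
  rcases hj.eq_or_lt with rfl | h
  · simp
  · exact hε j h hjd

/-- This recursion is what the weights are designed for: 16R²/ε₁, the constant of the cross-term
bound, times ε_{k+1} equals (d/2 − k − ε₁)ε_k, the size of the negative boundary term one order
below. -/
theorem IsBoundaryWeight.succ (hε : IsBoundaryWeight d R ε) {k : ℕ} (hk : 1 ≤ k)
    (hkd : ((k + 1 : ℕ) : ℝ) < (d : ℝ) / 2 + 1) :
    ε (k + 1) = ε 1 / (16 * R ^ 2) * ((d : ℝ) / 2 - k - ε 1) * ε k := by
  obtain ⟨m, rfl⟩ : ∃ m, k = m + 1 := ⟨k - 1, by omega⟩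
  rw [hε.eq (by omega) hkd, hε.eq hk (by push_cast at hkd ⊢; linarith)]
  simp only [Nat.add_sub_cancel, Finset.prod_Icc_succ_top (show 1 ≤ m + 1 by omega), pow_succ]
  ring

theorem IsBoundaryWeight.pos (hR : 0 < R) (h0 : 0 < ε 1) (h1 : ε 1 < 1 / 2)
    (hε : IsBoundaryWeight d R ε) {j : ℕ} (hj : 1 ≤ j) (hjd : (j : ℝ) < (d : ℝ) / 2 + 1) :
    0 < ε j := by
  rw [hε.eq hj hjd]
  refine mul_pos (by positivity) (Finset.prod_pos fun i hi => half_sub_pos h1 ?_)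
  have : i + 1 ≤ j := by have := Finset.mem_Icc.1 hi; omega
  have : (i + 1 : ℝ) ≤ j := by exact_mod_cast this
  linarith

theorem sum_boundarySq_opD (hR : 0 < R) {f : Pair d} (hf : IsSmoothPair R f) :
    ∑ μ : Fin (d + 1), boundarySq R (opD R μ f) =
      ∫ x, energyDensity R f x ∂sphereMeasure d R := by
  have h1 := integrable_sphereMeasure hR (ContDiffOn.norm_sq ℝ hf.2).continuousOn
  have h2 : ∀ i, Integrable (fun x => ‖partialDeriv R i f.1 x‖ ^ 2) (sphereMeasure d R) :=
    fun i => integrable_sphereMeasure hR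
      ((SmoothOnBall.partialDeriv hR hf.1 i).norm_sq ℝ).continuousOn
  rw [Fin.sum_univ_succ]
  simp only [energyDensity]
  rw [integral_add (integrable_finsetSum _ fun i _ => h2 i) h1,
    integral_finsetSum _ fun i _ => h2 i, add_comm]
  rfl

/-- Young's inequality with parameter η, then ‖a − b‖² ≤ 2(‖a‖² + ‖b‖²) ≤ 2R²(G + ‖a‖²). The
constant 16 is chosen to match the weights; the argument gives 2. -/
theorem boundary_cross_term_le {R s η G : ℝ} (hR : 1 ≤ R) (hη : 0 < η) {a b c : ℂ}
    (hb : ‖b‖ ^ 2 ≤ R ^ 2 * G) :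
    inner ℝ (-s • c - b + a) c ≤ 16 * R ^ 2 / η * (G + ‖a‖ ^ 2) + (η - s) * ‖c‖ ^ 2 := by
  have hin : inner ℝ (-s • c - b + a) c = -s * ‖c‖ ^ 2 + inner ℝ (a - b) c := by
    rw [show -s • c - b + a = -s • c + (a - b) by abel, inner_add_left, real_inner_smul_left,
      real_inner_self_eq_norm_sq]
  have hcs : inner ℝ (a - b) c ≤ ‖a - b‖ * ‖c‖ := real_inner_le_norm _ _
  have hab : ‖a - b‖ ^ 2 ≤ 2 * (‖a‖ ^ 2 + ‖b‖ ^ 2) := by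
    have := parallelogram_law_with_norm ℝ a b
    nlinarith [sq_nonneg ‖a + b‖]
  have ha : ‖a‖ ^ 2 ≤ R ^ 2 * ‖a‖ ^ 2 :=
    le_mul_of_one_le_left (sq_nonneg _) (one_le_pow₀ hR)
  have hyoung : ‖a - b‖ * ‖c‖ ≤ ‖a - b‖ ^ 2 / η + η * ‖c‖ ^ 2 := by
    have h : ‖a - b‖ ^ 2 / η + η * ‖c‖ ^ 2 - ‖a - b‖ * ‖c‖ =
        ((‖a - b‖ - η * ‖c‖) ^ 2 + η * (‖a - b‖ * ‖c‖)) / η := by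
      field_simp
      ring
    have : 0 ≤ ((‖a - b‖ - η * ‖c‖) ^ 2 + η * (‖a - b‖ * ‖c‖)) / η := by positivity
    linarith
  have hfin : ‖a - b‖ ^ 2 / η ≤ 16 * R ^ 2 / η * (G + ‖a‖ ^ 2) := by
    rw [div_mul_eq_mul_div]
    have : 0 ≤ R ^ 2 * (G + ‖a‖ ^ 2) := by nlinarith [sq_nonneg ‖b‖, sq_nonneg ‖a‖]
    gcongr
    linarith
  rw [hin]
  linarith

theorem integral_boundary_cross_term_le (hR : 1 ≤ R) {η : ℝ} (hη : 0 < η) {f : Pair d}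
    (hf : IsSmoothPair R f) (p : ℝ) :
    ∫ x, inner ℝ ((waveOp p R f).1 x) (f.1 x) ∂sphereMeasure d R ≤
      16 * R ^ 2 / η * (∫ x, energyDensity R f x ∂sphereMeasure d R)
        + (η - scalingExp p) * boundarySq R f := by
  have h0 : 0 < R := by linarith
  have he := integrable_sphereMeasure h0 (hf.energyDensity h0).continuousOn
  have hn := integrable_sphereMeasure h0 (ContDiffOn.norm_sq ℝ hf.1).continuousOn
  rw [boundarySq, ← integral_const_mul, ← integral_const_mul,
    ← integral_add (he.const_mul _) (hn.const_mul _)]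
  refine integral_mono_ae (integrable_sphereMeasure h0
    (ContDiffOn.inner ℝ (hf.waveOp h0 p).1 hf.1).continuousOn)
    ((he.const_mul _).add (hn.const_mul _)) (ae_sphereMeasure h0 fun x hx => ?_)
  simp only [waveOp_fst]
  refine boundary_cross_term_le hR hη ?_
  rw [← hx]
  exact norm_eulerOp_sq_le f.1 x

/-- The dissipation estimate at low order. -/
theorem re_energyForm_waveOp_le_of_lt (hd : 1 ≤ d) (hR : 1 ≤ R) (h0 : 0 < ε 1)
    (h1 : ε 1 < 1 / 2) (hε : IsBoundaryWeight d R ε) (p : ℝ) {k : ℕ} (hk : 1 ≤ k) :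
    (k : ℝ) < (d : ℝ) / 2 + 1 → ∀ {f : Pair d}, IsSmoothPair R f →
    (energyForm R ε k (waveOp p R f) f).re ≤
      ((d : ℝ) / 2 - scalingExp p - k) * (energyForm R ε k f f).re
        + (-((d : ℝ) / 2) + k + ε 1) * (2 * ε k / R * boundarySq R f) := by
  have hR0 : 0 < R := by linarith
  induction k, hk using Nat.le_induction with
  | base =>
    intro _ f hf
    simpa using re_energyForm_one_waveOp_le hd hR hf p
  | succ k hk ih =>
    intro hkd f hf
    have hkd' : (k : ℝ) < (d : ℝ) / 2 := by push_cast at hkd; linarith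
    have hpos := hε.pos hR0 h0 h1 (by omega) hkd
    have hc := half_sub_pos h1 hkd'
    have hsucc := hε.succ hk hkd
    have hself : ∫ x, inner ℝ (f.1 x) (f.1 x) ∂sphereMeasure d R = boundarySq R f := by
      simp only [real_inner_self_eq_norm_sq, boundarySq]
    rw [re_energyForm_succ_of_lt hR0 hk hkd (hf.waveOp hR0 p) hf,
      re_energyForm_succ_of_lt hR0 hk hkd hf hf, hself]
    -- The inductive hypothesis is summed over all D_μ f; the extra −1 in the rate comes from the
    -- commutator.
    have hsum : ∑ μ : Fin (d + 1), (energyForm R ε k (opD R μ (waveOp p R f)) (opD R μ f)).re ≤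
        ((d : ℝ) / 2 - scalingExp p - k - 1) *
            ∑ μ : Fin (d + 1), (energyForm R ε k (opD R μ f) (opD R μ f)).re
          + (-((d : ℝ) / 2) + k + ε 1) * (2 * ε k / R *
            ∫ x, energyDensity R f x ∂sphereMeasure d R) := by
      rw [← sum_boundarySq_opD hR0 hf, Finset.mul_sum, Finset.mul_sum, Finset.mul_sum,
        ← Finset.sum_add_distrib]
      refine Finset.sum_le_sum fun μ _ => ?_
      rw [energyForm_opD_waveOp hR0 hf, Complex.sub_re]
      have := ih (by linarith) (hf.opD hR0 μ)
      linarith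
    have hcross := mul_le_mul_of_nonneg_left (integral_boundary_cross_term_le hR h0 hf p)
      (show 0 ≤ 2 * ε (k + 1) / R by positivity)
    -- The positive density term from the cross term equals the negative one in `hsum` in size, so
    -- the two cancel in the final sum.
    have hcoef : 2 * ε (k + 1) / R * (16 * R ^ 2 / ε 1) =
        ((d : ℝ) / 2 - k - ε 1) * (2 * ε k / R) := by
      rw [hsucc]
      field_simp
    rw [mul_add, ← mul_assoc, hcoef] at hcross
    push_cast
    linarith

/-- The dissipation estimate at high order. -/
theorem re_energyForm_waveOp_le_of_le (hd : 1 ≤ d) (hR : 1 ≤ R) (h0 : 0 < ε 1)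
    (h1 : ε 1 < 1 / 2) (hε : IsBoundaryWeight d R ε) (p : ℝ) {k : ℕ} (hk : 1 ≤ k) :
    (d : ℝ) / 2 + 1 ≤ k → ∀ {f : Pair d}, IsSmoothPair R f →
    (energyForm R ε k (waveOp p R f) f).re ≤
      (-scalingExp p + ε 1) * (energyForm R ε k f f).re := by
  have hR0 : 0 < R := by linarith
  have hd1 : (1 : ℝ) ≤ d := by exact_mod_cast hd
  have hεpos : ∀ j : ℕ, 1 ≤ j → (j : ℝ) < (d : ℝ) / 2 + 1 → 0 < ε j :=
    fun j => hε.pos hR0 h0 h1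
  induction k, hk using Nat.le_induction with
  | base =>
    intro h
    push_cast at h
    linarith
  | succ k hk ih =>
    intro hkd f hf
    -- For d/2 ≤ k < d/2 + 1 the low-order estimate already gives this rate, since (d/2 − s − k) +
    -- (−d/2 + k + ε₁) = −s + ε₁ once the boundary term is absorbed.
    have key : ∀ {g : Pair d}, IsSmoothPair R g → (energyForm R ε k (waveOp p R g) g).re ≤
        (-scalingExp p + ε 1) * (energyForm R ε k g g).re := by
      intro g hg
      rcases lt_or_ge (k : ℝ) ((d : ℝ) / 2 + 1) with hlt | hle
      · have hge : (d : ℝ) / 2 ≤ k := by push_cast at hkd; linarith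
        have := re_energyForm_waveOp_le_of_lt hd hR h0 h1 hε p hk hlt hg
        have hb := mul_le_mul_of_nonneg_left
          (boundarySq_le_energyForm hR0 hd hεpos hk hlt hg)
          (show 0 ≤ -((d : ℝ) / 2) + k + ε 1 by linarith)
        linarith
      · exact ih hle hg
    rw [re_energyForm_succ_of_le hk hkd, re_energyForm_succ_of_le hk hkd, mul_add,
      Finset.mul_sum]
    refine add_le_add (Finset.sum_le_sum fun μ _ => ?_) (key hf)
    rw [energyForm_opD_waveOp hR0 hf, Complex.sub_re]
    -- The commutator's gain is not needed here: it is dropped by positivity.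
    have := re_energyForm_self_nonneg hR0 hεpos k hd (hf.opD hR0 μ)
    have := key (hf.opD hR0 μ)
    linarith

end WaveEnergy

end

theorem proposition2p1 (d k : ℕ) (p R : ℝ) (hd : 1 ≤ d) (hk : 1 ≤ k) (hp : 1 < p) (hR : 1 ≤ R)
    (ε : ℕ → ℝ) (hε_pos : 0 < ε 1) (hε_lt : ε 1 < 1 / 2)
    (hε : ∀ j : ℕ, 2 ≤ j → (j : ℝ) < (d : ℝ) / 2 + 1 →
      ε j = (ε 1 / (16 * R ^ 2)) ^ (j - 1) * ε 1 *
        ∏ i ∈ Finset.Icc 1 (j - 1), ((d : ℝ) / 2 - (i : ℝ) - ε 1))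
    (f : WaveEnergy.Pair d) (hf : WaveEnergy.IsSmoothPair R f) :
    ((k : ℝ) < (d : ℝ) / 2 + 1 →
      (WaveEnergy.energyForm R ε k (WaveEnergy.waveOp p R f) f).re ≤
        ((d : ℝ) / 2 - WaveEnergy.scalingExp p - (k : ℝ)) * WaveEnergy.energyNorm R ε k f ^ 2
          + (-((d : ℝ) / 2) + (k : ℝ) + ε 1) *
              (2 * ε k / R * ∫ x, ‖f.1 x‖ ^ 2 ∂WaveEnergy.sphereMeasure d R)) ∧
    ((d : ℝ) / 2 + 1 ≤ (k : ℝ) →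
      (WaveEnergy.energyForm R ε k (WaveEnergy.waveOp p R f) f).re ≤
        (-WaveEnergy.scalingExp p + ε 1) * WaveEnergy.energyNorm R ε k f ^ 2) := by
  have hR0 : 0 < R := by linarith
  have hw : WaveEnergy.IsBoundaryWeight d R ε := hε
  have hnorm : WaveEnergy.energyNorm R ε k f ^ 2 = (WaveEnergy.energyForm R ε k f f).re :=
    Real.sq_sqrt (WaveEnergy.re_energyForm_self_nonneg hR0
      (fun _ => hw.pos hR0 hε_pos hε_lt) k hd hf)
  rw [hnorm]
  exact ⟨fun h => WaveEnergy.re_energyForm_waveOp_le_of_lt hd hR hε_pos hε_lt hw p hk h hf,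
    fun h => WaveEnergy.re_energyForm_waveOp_le_of_le hd hR hε_pos hε_lt hw p hk h hf⟩
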